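/- Let $\mathfrak g$ be a finite-dimensional complex reductive Lie algebra and $\sigma$ an automorphism of $\mathfrak g$ of second order ($\sigma^2=1$). Let $\mathfrak g_{\bar j}$ be the eigenspace of $\sigma$ for the eigenvalue $(-1)^j$, and $\widetilde{\mathfrak g}^\sigma=\bigoplus_{j\in\mathbb Z}\mathfrak g_{\bar j}\otimes u^j$ the twisted loop algebra. An element $L$ of its linear dual is written $L(u)=\sum_j L^{(j)}u^{-j}$, $L^{(j)}\in\mathfrak g_{\bar j}^*$, where $L^{(j)}$ pairs with $\mathfrak g_{\bar j}\otimes u^j$. Suppose $\mathfrak g_{\bar 0}=\mathfrak g_{\bar 0}^+\oplus\mathfrak g_{\bar 0}^-$ is a direct sum of two reductive ideals, with projections $P_0^\pm$, and let $L^{(0)}=L^{(0)}_++L^{(0)}_-$, $L^{(0)}_\pm=(P_0^\pm)^*L^{(0)}$, be the corresponding decomposition of $L^{(0)}\in\mathfrak g_{\bar 0}^*$. Let $R_0=P_0^+-P_0^-$, $r_\pm=\tfrac12(1\pm R_0)$, and let $R=P_++R_0-P_-$ be the triangular operator on $\widetilde{\mathfrak g}^\sigma$, where $P_\pm$ project onto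 the loops of positive and of negative degree in $u$. For every polynomial function $I$ on $\mathfrak g^*$ that is invariant under the coadjoint representation, let $I^{\pm n}(L)$, $n\ge 0$, be the coefficient of $u^{\mp n}$ in $I\big(((R^*\pm1)L)(u)\big)$, with algebra-valued gradient $\nabla I^{\pm n}(L)\in\widetilde{\mathfrak g}^\sigma$ and with Hamiltonian flow $\frac{d}{dt}\langle L,X\rangle=\langle L,[X,\nabla I^{\pm n}(L)]\rangle$, $X\in\widetilde{\mathfrak g}^\sigma$, for the Lie-Poisson bracket $\{F,H\}(L)=\langle L,[\nabla F(L),\nabla H(L)]\rangle$. Then: 1. $R_0$ satisfies the modified Yang-Baxter equation $R_0([R_0X,Y]+[X,R_0Y])-[R_0X,R_0Y]=[X,Y]$ on $\mathfrak g_{\bar 0}$. 2. All $I^{\pm n}$ have gradients, $r_\pm^*(L^{(0)})=L^{(0)}_\pm$, and $L^{(0)}_+$, $L^{(0)}_-$ are constant along all these flows: all components of $L^{(0)}$ Poisson commute with all $I^{\pm n}$, and $r_\pm^*(L^{(0)})$ is constant along every solution of every flow on an open interval. 3. Let $K_\pm\in\zeta(\mathfrak g_{\bar 0}^\pm)^*$,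 where $\zeta$ denotes the center. There is exactly one element of $\mathfrak g_{\bar 0}^*$ that restricts to $K_\pm$ on $\zeta(\mathfrak g_{\bar 0}^\pm)$ and vanishes on $[\mathfrak g_{\bar 0}^\pm,\mathfrak g_{\bar 0}^\pm]$; it is denoted by $K_++K_-$. The reduction $L^{(0)}=K_++K_-$ is consistent with all equations of the hierarchy: on the surface $\{L: L^{(0)}=K_++K_-\}$ the components of $L^{(0)}$ Poisson commute with each other, every solution of a flow on an open interval that meets this surface stays in it, and at all points of this surface the zero-curvature equations $$\frac{\partial\nabla H_1}{\partial t_2}-\frac{\partial\nabla H_2}{\partial t_1}+[\nabla H_1,\nabla H_2]=0$$ hold for all $H_1=I_1^{\pm n_1}$, $H_2=I_2^{\pm n_2}$ with all combinations of the signs, where $\partial/\partial t_i$ is the derivative along the flow of $H_i$. -/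

import Mathlib

open scoped TensorProduct

noncomputable section

namespace LoopHierarchy

/-! ### Classical R-operators -/

/-- `R` is a classical R-operator: it solves the modified Yang-Baxter equation
`R([R X, Y] + [X, R Y]) - [R X, R Y] = [X, Y]`. -/
def IsROperator {𝔨 : Type*} [LieRing 𝔨] [LieAlgebra ℂ 𝔨] (R : 𝔨 →ₗ[ℂ] 𝔨) : Prop :=
  ∀ X Y : 𝔨, R (⁅R X, Y⁆ + ⁅X, R Y⁆) - ⁅R X, R Y⁆ = ⁅X, Y⁆

/-- The map `r_ε = (1 + ε R) / 2`, for a sign `ε = ±1`. -/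
def rMap {V : Type*} [AddCommGroup V] [Module ℂ V] (R : V →ₗ[ℂ] V) (ε : ℤˣ) : V →ₗ[ℂ] V :=
  (1 / 2 : ℂ) • (LinearMap.id + (ε : ℤ) • R)

/-! ### Hamiltonian mechanics on the full linear dual of a Lie algebra -/

section Hamiltonian

variable {G : Type*} [LieRing G] [LieAlgebra ℂ G]

/-- `X` is the algebra-valued gradient of `H` at `L`: the derivative of `H` at `L` in every
direction `M` is `⟨M, X⟩`. -/
def HasAlgGradientAt (H : Module.Dual ℂ G → ℂ) (L : Module.Dual ℂ G) (X : G) : Prop :=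
  ∀ M : Module.Dual ℂ G, HasDerivAt (fun z : ℂ => H (L + z • M)) (M X) 0

open Classical in
/-- The algebra-valued gradient `∇H(L)` (with value `0` where there is none). -/
def nabla (H : Module.Dual ℂ G → ℂ) (L : Module.Dual ℂ G) : G :=
  if h : ∃ X, HasAlgGradientAt H L X then h.choose else 0

/-- The linear coordinate function `L ↦ ⟨L, X⟩`. -/
def coordFun (X : G) (L : Module.Dual ℂ G) : ℂ := L X

/-- The Lie-Poisson bracket `{F, H}(L) = ⟨L, [∇F(L), ∇H(L)]⟩`. -/
def poisson (F H : Module.Dual ℂ G → ℂ) (L : Module.Dual ℂ G) : ℂ :=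
  L ⁅nabla F L, nabla H L⁆

/-- The curve `γ` satisfies, at time `t`, the Hamiltonian equation
`d⟨γ, X⟩/dt = {⟨·, X⟩, H} = ⟨γ, [X, ∇H(γ)]⟩` for all `X`, that is, `dγ/dt = ad^*_{∇H(γ)} γ`. -/
def SatisfiesFlowAt (H : Module.Dual ℂ G → ℂ) (γ : ℝ → Module.Dual ℂ G) (t : ℝ) : Prop :=
  ∀ X : G, HasDerivAt (fun s : ℝ => γ s X) (γ t ⁅X, nabla H (γ t)⁆) t

/-- `A` is the time derivative at `L` of the `G`-valued function `F` along the flow of `H`: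
along every curve through `L` that satisfies the Hamiltonian equation of `H` when it passes
through `L`, the function `F` has derivative `A` (tested against all functionals). -/
def HasFlowDerivAt (H : Module.Dual ℂ G → ℂ) (F : Module.Dual ℂ G → G)
    (L : Module.Dual ℂ G) (A : G) : Prop :=
  ∀ (γ : ℝ → Module.Dual ℂ G) (t : ℝ), γ t = L → SatisfiesFlowAt H γ t →
    ∀ M : Module.Dual ℂ G, HasDerivAt (fun s : ℝ => M (F (γ s))) (M A) t

/-- The zero-curvature equation `∂∇H₁/∂t₂ - ∂∇H₂/∂t₁ + [∇H₁, ∇H₂] = 0` at the point `L`, where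
`t₁`, `t₂` are the times of the flows of `H₁`, `H₂`. The existence of both time derivatives is
part of it. -/
def ZeroCurvatureAt (H₁ H₂ : Module.Dual ℂ G → ℂ) (L : Module.Dual ℂ G) : Prop :=
  ∃ A B : G, HasFlowDerivAt H₂ (nabla H₁) L A ∧ HasFlowDerivAt H₁ (nabla H₂) L B ∧
    A - B + ⁅nabla H₁ L, nabla H₂ L⁆ = 0

end Hamiltonian

/-! ### Coadjoint invariants -/

section Invariants

variable {𝔤 : Type*} [LieRing 𝔤] [LieAlgebra ℂ 𝔤]

/-- For `x ∈ 𝔤` the algebra map `S(𝔤) → S(𝔤)[ε]`, `y ↦ y + ε [x, y]` on `𝔤`. Its `ε`-part is the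
derivation of `S(𝔤)` that extends `ad x`. -/
def symAd (x : 𝔤) :
    SymmetricAlgebra ℂ 𝔤 →ₐ[ℂ] TrivSqZeroExt (SymmetricAlgebra ℂ 𝔤) (SymmetricAlgebra ℂ 𝔤) :=
  SymmetricAlgebra.lift
    ((TrivSqZeroExt.inlAlgHom ℂ (SymmetricAlgebra ℂ 𝔤) (SymmetricAlgebra ℂ 𝔤)).toLinearMap ∘ₗ
        SymmetricAlgebra.ι ℂ 𝔤 +
      ((TrivSqZeroExt.inrHom (SymmetricAlgebra ℂ 𝔤)
          (SymmetricAlgebra ℂ 𝔤)).restrictScalars ℂ) ∘ₗ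
        SymmetricAlgebra.ι ℂ 𝔤 ∘ₗ (LieAlgebra.ad ℂ 𝔤 x : 𝔤 →ₗ[ℂ] 𝔤))

/-- `I`, a polynomial function on `𝔤^*`, that is, an element of `S(𝔤)`, is invariant under the
coadjoint representation. -/
def IsCoadjointInvariant (I : SymmetricAlgebra ℂ 𝔤) : Prop :=
  ∀ x : 𝔤, (symAd x I).snd = 0

end Invariants

/-! ### The loop algebra twisted by an involutive automorphism -/

section Twisted

variable {𝔤 : Type*} [LieRing 𝔤] [LieAlgebra ℂ 𝔤] (σ : 𝔤 ≃ₗ⁅ℂ⁆ 𝔤)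

/-- The subalgebra `𝔤_0` of `σ`-invariants. -/
def fixedSubalgebra : LieSubalgebra ℂ 𝔤 where
  carrier := {x | σ x = x}
  add_mem' := by
    intro a b ha hb
    simp only [Set.mem_ofPred_eq] at ha hb ⊢
    rw [map_add, ha, hb]
  zero_mem' := by simp
  smul_mem' := by
    intro c x hx
    simp only [Set.mem_ofPred_eq] at hx ⊢
    rw [map_smul, hx]
  lie_mem' := by
    intro a b ha hb
    change σ a = a at ha
    change σ b = b at hb
    change σ ⁅a, b⁆ = ⁅a, b⁆
    rw [LieEquiv.map_lie, ha, hb]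

/-- The homogeneous loop `x ⊗ u^j`, linear in `x`. -/
def loopMono (j : ℤ) : 𝔤 →ₗ[ℂ] LieAlgebra.loopAlgebra ℂ ℤ 𝔤 :=
  TensorProduct.mk ℂ (AddMonoidAlgebra ℂ ℤ) 𝔤 (AddMonoidAlgebra.single j 1)

/-- The coefficient `x_j ∈ 𝔤` of a loop `∑ x_j ⊗ u^j`. -/
def loopCoeff (j : ℤ) : LieAlgebra.loopAlgebra ℂ ℤ 𝔤 →ₗ[ℂ] 𝔤 :=
  Finsupp.lapply j ∘ₗ (LieAlgebra.LoopAlgebra.toFinsupp ℂ ℤ 𝔤).toLinearMap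

theorem loopCoeff_loopMono (i j : ℤ) (x : 𝔤) :
    loopCoeff i (loopMono j x) = if j = i then x else 0 := by
  classical
  change (LieAlgebra.LoopAlgebra.toFinsupp ℂ ℤ 𝔤)
    (AddMonoidAlgebra.single j 1 ⊗ₜ[ℂ] x) i = _
  rw [LieAlgebra.LoopAlgebra.toFinsupp_single_tmul, Finsupp.single_apply]

theorem sum_loopMono (X : LieAlgebra.loopAlgebra ℂ ℤ 𝔤) :
    (LieAlgebra.LoopAlgebra.toFinsupp ℂ ℤ 𝔤 X).sum (fun j x => loopMono j x) = X := by
  apply (LieAlgebra.LoopAlgebra.toFinsupp ℂ ℤ 𝔤).injective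
  rw [Finsupp.sum, map_sum]
  simp only [loopMono, TensorProduct.mk_apply, LieAlgebra.LoopAlgebra.toFinsupp_single_tmul]
  exact Finsupp.sum_single _

theorem loopMono_lie (i j : ℤ) (x y : 𝔤) :
    ⁅loopMono i x, loopMono j y⁆ = loopMono (i + j) ⁅x, y⁆ := by
  change (AddMonoidAlgebra.single i (1 : ℂ) * AddMonoidAlgebra.single j 1) ⊗ₜ[ℂ] ⁅x, y⁆ = _
  rw [AddMonoidAlgebra.single_mul_single, mul_one]
  rfl

/-- The loops `∑ x_j ⊗ u^j` with `σ x_j = (-1)^j x_j` for all `j`. -/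
def twistedSubmodule : Submodule ℂ (LieAlgebra.loopAlgebra ℂ ℤ 𝔤) where
  carrier := {X | ∀ j : ℤ, σ (loopCoeff j X) = (-1 : ℂ) ^ j • loopCoeff j X}
  add_mem' := by
    intro X Y hX hY j
    rw [map_add, map_add, hX j, hY j, smul_add]
  zero_mem' := by
    intro j
    simp
  smul_mem' := by
    intro c X hX j
    rw [map_smul, map_smul, hX j, smul_comm]

theorem loopMono_mem {j : ℤ} {x : 𝔤} (hx : σ x = (-1 : ℂ) ^ j • x) :
    loopMono j x ∈ twistedSubmodule σ := by
  intro i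
  rw [loopCoeff_loopMono]
  split_ifs with h
  · rw [← h, hx]
  · simp

/-- The twisted loop algebra: the Lie subalgebra `⨁_j 𝔤_j ⊗ u^j` of the loop algebra of `𝔤`, where
`𝔤_j` is the eigenspace of `σ` for the eigenvalue `(-1)^j`. -/
def twistedLoop : LieSubalgebra ℂ (LieAlgebra.loopAlgebra ℂ ℤ 𝔤) where
  toSubmodule := twistedSubmodule σ
  lie_mem' := by
    intro X Y hX hY
    change ⁅X, Y⁆ ∈ twistedSubmodule σ
    have hX' : ∀ j, σ (loopCoeff j X) = (-1 : ℂ) ^ j • loopCoeff j X := hX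
    have hY' : ∀ j, σ (loopCoeff j Y) = (-1 : ℂ) ^ j • loopCoeff j Y := hY
    rw [← sum_loopMono X, ← sum_loopMono Y, Finsupp.sum, Finsupp.sum, sum_lie_sum]
    refine Submodule.sum_mem _ fun i _ => Submodule.sum_mem _ fun j _ => ?_
    rw [loopMono_lie]
    apply loopMono_mem
    have h1 := hX' i
    have h2 := hY' j
    change σ ((LieAlgebra.LoopAlgebra.toFinsupp ℂ ℤ 𝔤) X i) =
      _ • (LieAlgebra.LoopAlgebra.toFinsupp ℂ ℤ 𝔤) X i at h1
    change σ ((LieAlgebra.LoopAlgebra.toFinsupp ℂ ℤ 𝔤) Y j) =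
      _ • (LieAlgebra.LoopAlgebra.toFinsupp ℂ ℤ 𝔤) Y j at h2
    rw [LieEquiv.map_lie, h1, h2, smul_lie, lie_smul, smul_smul,
      zpow_add₀ (by norm_num : (-1 : ℂ) ≠ 0)]

/-- The part of a twisted loop whose degrees satisfy `p`. -/
def truncate (p : ℤ → Prop) [DecidablePred p] : twistedLoop σ →ₗ[ℂ] twistedLoop σ :=
  LinearMap.restrict
    ((LieAlgebra.LoopAlgebra.toFinsupp ℂ ℤ 𝔤).symm.toLinearMap ∘ₗ
      ({ toFun := Finsupp.filter p
         map_add' := fun f g => Finsupp.filter_add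
         map_smul' := fun c f => Finsupp.filter_smul } : (ℤ →₀ 𝔤) →ₗ[ℂ] (ℤ →₀ 𝔤)) ∘ₗ
      (LieAlgebra.LoopAlgebra.toFinsupp ℂ ℤ 𝔤).toLinearMap)
    (p := twistedSubmodule σ) (q := twistedSubmodule σ)
    (by
      intro X hX j
      have h : σ ((LieAlgebra.LoopAlgebra.toFinsupp ℂ ℤ 𝔤) X j) =
        (-1 : ℂ) ^ j • (LieAlgebra.LoopAlgebra.toFinsupp ℂ ℤ 𝔤) X j := hX j
      by_cases hp : p j
      · simpa [loopCoeff, Finsupp.filter_apply, hp] using h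
      · simp [loopCoeff, hp])

/-- The inclusion of `𝔤_0` as the constant loops. -/
def constLoop : fixedSubalgebra σ →ₗ[ℂ] twistedLoop σ where
  toFun x := ⟨loopMono 0 (x : 𝔤), loopMono_mem σ (by
    have h : σ (x : 𝔤) = x := x.2
    simpa using h)⟩
  map_add' x y := Subtype.ext (map_add (loopMono 0) (x : 𝔤) (y : 𝔤))
  map_smul' c x := Subtype.ext (map_smul (loopMono 0) c (x : 𝔤))

/-- The coefficient of `u^0`, the projection of the twisted loop algebra onto `𝔤_0`. -/
def zeroCoeff : twistedLoop σ →ₗ[ℂ] fixedSubalgebra σ where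
  toFun X := ⟨loopCoeff 0 X, by
    have h := X.2 0
    rw [zpow_zero, one_smul] at h
    exact h⟩
  map_add' X Y := Subtype.ext (map_add (loopCoeff 0) (X : LieAlgebra.loopAlgebra ℂ ℤ 𝔤) Y)
  map_smul' c X := Subtype.ext (map_smul (loopCoeff 0) c (X : LieAlgebra.loopAlgebra ℂ ℤ 𝔤))

/-- The triangular R-operator `P_+ + R_0 - P_-`, where `P_±` are the projections onto the loops of
positive and of negative degree. -/
def triangularR (R₀ : fixedSubalgebra σ →ₗ[ℂ] fixedSubalgebra σ) :
    twistedLoop σ →ₗ[ℂ] twistedLoop σ :=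
  truncate σ (fun j => 0 < j) + constLoop σ ∘ₗ R₀ ∘ₗ zeroCoeff σ - truncate σ (fun j => j < 0)

/-- The component `L^(0) ∈ 𝔤_0^*` of an element `L` of the dual of the twisted loop algebra. -/
def zeroPart (L : Module.Dual ℂ (twistedLoop σ)) : Module.Dual ℂ (fixedSubalgebra σ) :=
  L ∘ₗ constLoop σ

variable (hσ : ∀ x, σ (σ x) = x)

/-- `x ↦ π_j(x) ⊗ u^j`, where `π_j = (1 + (-1)^j σ) / 2` is the projection of `𝔤` onto `𝔤_j`. -/
def twistedMono (j : ℤ) : 𝔤 →ₗ[ℂ] twistedLoop σ :=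
  LinearMap.codRestrict (twistedSubmodule σ)
    (loopMono j ∘ₗ ((1 / 2 : ℂ) • (LinearMap.id + (-1 : ℂ) ^ j • (σ : 𝔤 →ₗ[ℂ] 𝔤))))
    (by
      intro x
      apply loopMono_mem
      have h1 : (-1 : ℂ) ^ j * (-1 : ℂ) ^ j = 1 := by
        rw [← mul_zpow]; norm_num
      simp only [LinearMap.smul_apply, LinearMap.add_apply, LinearMap.id_apply]
      change σ ((1 / 2 : ℂ) • (x + (-1 : ℂ) ^ j • σ x)) =
        (-1 : ℂ) ^ j • ((1 / 2 : ℂ) • (x + (-1 : ℂ) ^ j • σ x))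
      rw [map_smul, map_add, map_smul, hσ, smul_comm ((-1 : ℂ) ^ j) (1 / 2 : ℂ), smul_add,
        smul_add, smul_add, smul_smul ((-1 : ℂ) ^ j), h1, one_smul, add_comm])

/-- The half with degrees `0, ε, 2ε, …` of the formal series `ξ(u) = ∑_j ξ^(j) u^(-j)`,
`ξ^(j) ∈ 𝔤_j^*`, of an element `ξ` of the dual of the twisted loop algebra, as a `𝔤^*`-valued power
series in the variable `u^(-ε)`: its `n`-th coefficient is the functional `ξ^(εn)` on `𝔤`. -/
def laxSeries (ε : ℤˣ) (ξ : Module.Dual ℂ (twistedLoop σ)) : 𝔤 →ₗ[ℂ] PowerSeries ℂ where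
  toFun x := PowerSeries.mk fun n => ξ (twistedMono σ hσ ((ε : ℤ) * n) x)
  map_add' x y := by
    ext n
    simp
  map_smul' c x := by
    ext n
    simp

/-- The integral `I^{εn}` of the hierarchy: the coefficient of `u^(-εn)` in `I(L_ε(u))`, where
`I ∈ S(𝔤)` is evaluated on the series of `L_ε = (R^* + ε) L`. For the triangular R-operator `R`
the functional `(R^* + ε) L` vanishes on all loops of degrees of sign opposite to `ε`, so that
`laxSeries` loses nothing. -/
def integral (R : twistedLoop σ →ₗ[ℂ] twistedLoop σ) (ε : ℤˣ) (I : SymmetricAlgebra ℂ 𝔤) (n : ℕ)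
    (L : Module.Dual ℂ (twistedLoop σ)) : ℂ :=
  PowerSeries.coeff n
    (SymmetricAlgebra.lift (laxSeries σ hσ ε (R.dualMap L + (ε : ℤ) • L)) I)

end Twisted

/-! ### Splitting of the zero component -/

section Splitting

variable {𝔥 : Type*} [LieRing 𝔥] [LieAlgebra ℂ 𝔥]

/-- The projection of `𝔥 = 𝔞 ⊕ 𝔟` onto `𝔞`, as a map `𝔥 → 𝔥`. -/
def idealProj (𝔞 𝔟 : LieIdeal ℂ 𝔥) (h : IsCompl 𝔞 𝔟) : 𝔥 →ₗ[ℂ] 𝔥 :=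
  Submodule.projection 𝔞.toSubmodule 𝔟.toSubmodule (LieSubmodule.isCompl_toSubmodule.mpr h)

/-- The Kostant-Adler-Symes R-operator `P_a - P_b` of `𝔥 = 𝔞 ⊕ 𝔟`. -/
def splitR (𝔞 𝔟 : LieIdeal ℂ 𝔥) (h : IsCompl 𝔞 𝔟) : 𝔥 →ₗ[ℂ] 𝔥 :=
  idealProj 𝔞 𝔟 h - idealProj 𝔟 𝔞 h.symm

/-- `κ ∈ 𝔥^*` is the element `k_a + k_b`, where `k_a ∈ ζ(𝔞)^*` and `k_b ∈ ζ(𝔟)^*` are regarded as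
elements of `𝔥^*` by the decomposition `𝔥 = ζ(𝔞) ⊕ [𝔞, 𝔞] ⊕ ζ(𝔟) ⊕ [𝔟, 𝔟]`. -/
def IsSumOfCentral (𝔞 𝔟 : LieIdeal ℂ 𝔥) (k_a : Module.Dual ℂ (LieAlgebra.center ℂ 𝔞))
    (k_b : Module.Dual ℂ (LieAlgebra.center ℂ 𝔟)) (κ : Module.Dual ℂ 𝔥) : Prop :=
  (∀ z : LieAlgebra.center ℂ 𝔞, κ ((z : 𝔞) : 𝔥) = k_a z) ∧
  (∀ x y : 𝔞, κ (⁅x, y⁆ : 𝔞) = 0) ∧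
  (∀ z : LieAlgebra.center ℂ 𝔟, κ ((z : 𝔟) : 𝔥) = k_b z) ∧
  (∀ x y : 𝔟, κ (⁅x, y⁆ : 𝔟) = 0)

end Splitting

/-- The integrals `I^{±n}` of the hierarchy of the twisted loop algebra and of the triangular
R-operator with `R_0 = P_0^+ - P_0^-`, where `𝔤_0 = gp ⊕ gm`. -/
def splitIntegral {𝔤 : Type*} [LieRing 𝔤] [LieAlgebra ℂ 𝔤] (σ : 𝔤 ≃ₗ⁅ℂ⁆ 𝔤)
    (hσ : ∀ x, σ (σ x) = x) (gp gm : LieIdeal ℂ (fixedSubalgebra σ)) (h : IsCompl gp gm)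
    (ε : ℤˣ) (I : SymmetricAlgebra ℂ 𝔤) (n : ℕ) (L : Module.Dual ℂ (twistedLoop σ)) : ℂ :=
  integral σ hσ (triangularR σ (splitR gp gm h)) ε I n L

end LoopHierarchy

end

open LoopHierarchy

namespace LoopHierarchy

/-! ### The universal derivation of a symmetric algebra -/

section SymmetricDerivation

variable {V : Type*} [AddCommGroup V] [Module ℂ V]

/-! Every integral is a polynomial function on the dual of the twisted loop algebra: expanding `I`
over power series with coefficients in a symmetric algebra gives `integralPoly`. Calculus thus
reduces to the universal derivation `symD`, and no topology on the infinite-dimensional dual is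
needed. The gradient of `I^{εn}` is `(R + ε)` applied to a finite truncation `gradLoop` of the
formal series `u^{εn} ∇I(L_ε(u))` (`nabla_integral`). The place of the cut is immaterial once all
terms whose degree is not opposite in sign to `ε` are kept, since `R + ε` kills the others.

Invariance of `I` says that `∇I(ξ)` centralizes `ξ`, for `ξ` with values in any commutative algebra.
On power series this yields `⟨L, (R + ε)[W, ∇I]⟩ = 0` for every loop `W`, with a truncation long
enough for `W` (`apply_shift_lie_gradLoop`). Two consequences follow. First, the modified
Yang-Baxter equation writes `[(R + ε)X, (R + ε')Y]` as a sum of two terms, each annihilated in this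
way, so all integrals are in involution, for equal and opposite signs alike. Second, the projections
onto ideals commute with `ad`, hence `R` commutes with `ad` of constant loops, and the components of
`L^(0)` are conserved.

Differentiating `{H₁, H₂} = 0` in an arbitrary direction and using symmetry of second derivatives
gives zero curvature. The functional `K_+ + K_-` exists and is unique because a reductive algebra
modulo its center is semisimple: existence is the vanishing of its second cohomology, uniqueness its
perfectness. It kills all brackets of the fixed subalgebra, so the constraints commute on the
surface. -/

/-- The map `S(V) → S(V) ⊕ (S(V) ⊗ V) ε` whose `ε`-part is the universal derivation. -/
noncomputable def symTaylor : SymmetricAlgebra ℂ V →ₐ[ℂ]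
    TrivSqZeroExt (SymmetricAlgebra ℂ V) (SymmetricAlgebra ℂ V ⊗[ℂ] V) :=
  SymmetricAlgebra.lift
    ((TrivSqZeroExt.inlAlgHom ℂ (SymmetricAlgebra ℂ V)
        (SymmetricAlgebra ℂ V ⊗[ℂ] V)).toLinearMap ∘ₗ SymmetricAlgebra.ι ℂ V +
      ((TrivSqZeroExt.inrHom (SymmetricAlgebra ℂ V)
          (SymmetricAlgebra ℂ V ⊗[ℂ] V)).restrictScalars ℂ) ∘ₗ
        TensorProduct.mk ℂ (SymmetricAlgebra ℂ V) V 1)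

theorem fst_symTaylor (P : SymmetricAlgebra ℂ V) : (symTaylor P).fst = P := by
  have h : (TrivSqZeroExt.fstHom ℂ (SymmetricAlgebra ℂ V)
      (SymmetricAlgebra ℂ V ⊗[ℂ] V)).comp symTaylor = AlgHom.id ℂ _ := by
    ext v
    simp [symTaylor]
  exact congrArg (fun f : SymmetricAlgebra ℂ V →ₐ[ℂ] SymmetricAlgebra ℂ V => f P) h

/-- The universal derivation `d : S(V) → S(V) ⊗ V`, `d v = 1 ⊗ v`. -/
noncomputable def symD (P : SymmetricAlgebra ℂ V) : SymmetricAlgebra ℂ V ⊗[ℂ] V :=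
  (symTaylor P).snd

@[simp] theorem symD_algebraMap (c : ℂ) :
    symD (algebraMap ℂ (SymmetricAlgebra ℂ V) c) = 0 := by
  rw [symD, AlgHom.commutes]
  rfl

@[simp] theorem symD_ι (v : V) : symD (SymmetricAlgebra.ι ℂ V v) = 1 ⊗ₜ v := by
  simp [symD, symTaylor]

@[simp] theorem symD_add (P Q : SymmetricAlgebra ℂ V) : symD (P + Q) = symD P + symD Q := by
  simp [symD]

@[simp] theorem symD_mul (P Q : SymmetricAlgebra ℂ V) :
    symD (P * Q) = P • symD Q + Q • symD P := by
  simp [symD, fst_symTaylor]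

variable {A : Type*} [CommRing A] [Algebra ℂ A]

/-- The contraction `S(V) ⊗ V → A`, `P ⊗ v ↦ P(ξ) η(v)`. -/
noncomputable def contr (ξ η : V →ₗ[ℂ] A) : SymmetricAlgebra ℂ V ⊗[ℂ] V →ₗ[ℂ] A :=
  LinearMap.mul' ℂ A ∘ₗ TensorProduct.map (SymmetricAlgebra.lift ξ).toLinearMap η

@[simp] theorem contr_tmul (ξ η : V →ₗ[ℂ] A) (P : SymmetricAlgebra ℂ V) (v : V) :
    contr ξ η (P ⊗ₜ v) = SymmetricAlgebra.lift ξ P * η v := by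
  simp [contr]

@[simp] theorem contr_smul (ξ η : V →ₗ[ℂ] A) (P : SymmetricAlgebra ℂ V)
    (T : SymmetricAlgebra ℂ V ⊗[ℂ] V) :
    contr ξ η (P • T) = SymmetricAlgebra.lift ξ P * contr ξ η T := by
  induction T with
  | zero => simp
  | tmul Q v => simp [TensorProduct.smul_tmul', mul_assoc]
  | add S T hS hT => rw [smul_add, map_add, hS, hT, map_add, mul_add]

/-- Naturality in the coefficient algebra; it carries identities from the symmetric algebra to power
series. -/
theorem algHom_contr {B : Type*} [CommRing B] [Algebra ℂ B] (φ : A →ₐ[ℂ] B) (ξ η : V →ₗ[ℂ] A)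
    (T : SymmetricAlgebra ℂ V ⊗[ℂ] V) :
    φ (contr ξ η T) = contr (φ.toLinearMap ∘ₗ ξ) (φ.toLinearMap ∘ₗ η) T := by
  have h : SymmetricAlgebra.lift (φ.toLinearMap ∘ₗ ξ) = φ.comp (SymmetricAlgebra.lift ξ) := by
    ext v
    simp
  induction T with
  | zero => simp
  | tmul Q v => simp [h]
  | add S T hS hT => rw [map_add, map_add, hS, hT, map_add]

/-- The value at the linear functional `ξ` of an element of `S(V) ⊗ V`, as a vector of `V`. -/
noncomputable def evalAt (ξ : V →ₗ[ℂ] ℂ) : SymmetricAlgebra ℂ V ⊗[ℂ] V →ₗ[ℂ] V :=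
  TensorProduct.lift (LinearMap.lsmul ℂ V ∘ₗ (SymmetricAlgebra.lift ξ).toLinearMap)

@[simp] theorem evalAt_tmul (ξ : V →ₗ[ℂ] ℂ) (P : SymmetricAlgebra ℂ V) (v : V) :
    evalAt ξ (P ⊗ₜ v) = SymmetricAlgebra.lift ξ P • v := by
  simp [evalAt]

theorem apply_evalAt (ξ η : V →ₗ[ℂ] ℂ) (T : SymmetricAlgebra ℂ V ⊗[ℂ] V) :
    η (evalAt ξ T) = contr ξ η T := by
  induction T with
  | zero => simp
  | tmul Q v => simp
  | add S T hS hT => rw [map_add, map_add, hS, hT, map_add]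

/-- The derivation of `S(V)` at the point `ξ` in the direction `η`. -/
noncomputable def dirDeriv (ξ η : V →ₗ[ℂ] ℂ) : SymmetricAlgebra ℂ V →ₗ[ℂ] ℂ where
  toFun P := contr ξ η (symD P)
  map_add' P Q := by simp
  map_smul' c P := by
    rw [Algebra.smul_def, symD_mul, symD_algebraMap, smul_zero, add_zero, contr_smul]
    simp

theorem dirDeriv_apply (ξ η : V →ₗ[ℂ] ℂ) (P : SymmetricAlgebra ℂ V) :
    dirDeriv ξ η P = contr ξ η (symD P) := rfl

theorem dirDeriv_mul (ξ η : V →ₗ[ℂ] ℂ) (P Q : SymmetricAlgebra ℂ V) :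
    dirDeriv ξ η (P * Q) =
      SymmetricAlgebra.lift ξ P * dirDeriv ξ η Q + SymmetricAlgebra.lift ξ Q * dirDeriv ξ η P := by
  simp [dirDeriv_apply]

/-- The derivative of `evalAt · T` at the point `ξ` in the direction `η`. -/
noncomputable def evalDeriv (ξ η : V →ₗ[ℂ] ℂ) : SymmetricAlgebra ℂ V ⊗[ℂ] V →ₗ[ℂ] V :=
  TensorProduct.lift (LinearMap.lsmul ℂ V ∘ₗ dirDeriv ξ η)

@[simp] theorem evalDeriv_tmul (ξ η : V →ₗ[ℂ] ℂ) (P : SymmetricAlgebra ℂ V) (v : V) :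
    evalDeriv ξ η (P ⊗ₜ v) = dirDeriv ξ η P • v := by
  simp [evalDeriv]

theorem apply_evalDeriv_smul (ξ η θ : V →ₗ[ℂ] ℂ) (P : SymmetricAlgebra ℂ V)
    (T : SymmetricAlgebra ℂ V ⊗[ℂ] V) :
    θ (evalDeriv ξ η (P • T)) =
      dirDeriv ξ η P * contr ξ θ T + SymmetricAlgebra.lift ξ P * θ (evalDeriv ξ η T) := by
  induction T with
  | zero => simp
  | tmul Q v =>
    simp only [TensorProduct.smul_tmul', evalDeriv_tmul, smul_eq_mul, map_smul, dirDeriv_mul,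
      contr_tmul]
    ring
  | add S T hS hT => simp only [smul_add, map_add, hS, hT]; ring

/-- The second derivative is symmetric. -/
theorem evalDeriv_symD_comm (ξ η θ : V →ₗ[ℂ] ℂ) (P : SymmetricAlgebra ℂ V) :
    θ (evalDeriv ξ η (symD P)) = η (evalDeriv ξ θ (symD P)) := by
  induction P using SymmetricAlgebra.induction with
  | algebraMap r => simp
  | ι x =>
    have h (η : V →ₗ[ℂ] ℂ) : dirDeriv ξ η 1 = 0 := by
      have := symD_algebraMap (V := V) 1
      rw [map_one] at this
      rw [dirDeriv_apply, this, map_zero]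
    simp [h]
  -- The cross terms `dP(η) dQ(θ) + dP(θ) dQ(η)` are already symmetric.
  | mul P Q hP hQ =>
    simp only [symD_mul, map_add, apply_evalDeriv_smul, ← dirDeriv_apply, hP, hQ]
    ring
  | add P Q hP hQ => simp only [symD_add, map_add, hP, hQ]

end SymmetricDerivation

/-! ### Polynomial Hamiltonians on the dual of a Lie algebra -/

section PolynomialHamiltonian

variable {G : Type*} [LieRing G] [LieAlgebra ℂ G]

section Curves

variable {𝕜 : Type*} [NontriviallyNormedField 𝕜] [NormedAlgebra 𝕜 ℂ]
  {γ : 𝕜 → Module.Dual ℂ G} {t : 𝕜} {δ : Module.Dual ℂ G}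

/-- A polynomial involves finitely many coordinates, so coordinatewise differentiability of the
curve suffices. The field is left general: flows are curves over `ℝ`, gradients use lines over `ℂ`.
-/
theorem hasDerivAt_lift (h : ∀ X, HasDerivAt (fun s => γ s X) (δ X) t)
    (P : SymmetricAlgebra ℂ G) :
    HasDerivAt (fun s => SymmetricAlgebra.lift (γ s) P) (dirDeriv (γ t) δ P) t := by
  induction P using SymmetricAlgebra.induction with
  | algebraMap r => simpa [dirDeriv_apply] using hasDerivAt_const t r
  | ι x => simpa [dirDeriv_apply] using h x
  | mul P Q hP hQ =>
    simp only [map_mul, dirDeriv_mul]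
    exact (hP.fun_mul hQ).congr_deriv (by ring)
  | add P Q hP hQ =>
    simp only [map_add]
    exact hP.fun_add hQ

theorem hasDerivAt_apply_evalAt (h : ∀ X, HasDerivAt (fun s => γ s X) (δ X) t)
    (T : SymmetricAlgebra ℂ G ⊗[ℂ] G) (θ : Module.Dual ℂ G) :
    HasDerivAt (fun s => θ (evalAt (γ s) T)) (θ (evalDeriv (γ t) δ T)) t := by
  induction T with
  | zero => simpa using hasDerivAt_const t (0 : ℂ)
  | tmul P v => simpa using (hasDerivAt_lift h P).mul_const (θ v)
  | add S T hS hT => simpa using hS.fun_add hT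

theorem hasDerivAt_lie (h : ∀ X, HasDerivAt (fun s => γ s X) (δ X) t)
    (S T : SymmetricAlgebra ℂ G ⊗[ℂ] G) :
    HasDerivAt (fun s => γ s ⁅evalAt (γ s) S, evalAt (γ s) T⁆)
      (δ ⁅evalAt (γ t) S, evalAt (γ t) T⁆ + γ t ⁅evalDeriv (γ t) δ S, evalAt (γ t) T⁆ +
        γ t ⁅evalAt (γ t) S, evalDeriv (γ t) δ T⁆) t := by
  induction S with
  | zero => simpa using hasDerivAt_const t (0 : ℂ)
  | tmul P v =>
    induction T with
    | zero => simpa using hasDerivAt_const t (0 : ℂ)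
    | tmul Q w =>
      simp only [evalAt_tmul, evalDeriv_tmul, smul_lie, lie_smul, map_smul, smul_eq_mul]
      exact ((hasDerivAt_lift h Q).fun_mul ((hasDerivAt_lift h P).fun_mul
        (h ⁅v, w⁆))).congr_deriv (by ring)
    | add S T hS hT =>
      simp only [map_add, lie_add]
      exact (hS.fun_add hT).congr_deriv (by ring)
  | add S S' hS hS' =>
    simp only [map_add, add_lie]
    exact (hS.fun_add hS').congr_deriv (by ring)

end Curves

theorem hasDerivAt_line (L M : Module.Dual ℂ G) (X : G) :
    HasDerivAt (fun z : ℂ => (L + z • M) X) (M X) 0 := by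
  simpa using ((hasDerivAt_id (0 : ℂ)).mul_const (M X)).const_add (L X)

/-- Linear functionals separate points, so a gradient is unique and the chosen one is the given one.
-/
theorem HasAlgGradientAt.nabla_eq {H : Module.Dual ℂ G → ℂ} {L : Module.Dual ℂ G} {X : G}
    (h : HasAlgGradientAt H L X) : nabla H L = X := by
  have hex : ∃ X, HasAlgGradientAt H L X := ⟨X, h⟩
  rw [nabla, dif_pos hex]
  rw [← sub_eq_zero, ← Module.forall_dual_apply_eq_zero_iff ℂ]
  intro M
  rw [map_sub, (hex.choose_spec M).unique (h M), sub_self]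

variable {H H₁ H₂ : Module.Dual ℂ G → ℂ} {P P₁ P₂ : SymmetricAlgebra ℂ G}

theorem hasAlgGradientAt_of_polynomial (hP : ∀ L, H L = SymmetricAlgebra.lift L P)
    (L : Module.Dual ℂ G) : HasAlgGradientAt H L (evalAt L (symD P)) := by
  intro M
  have h := hasDerivAt_lift (γ := fun z : ℂ => L + z • M) (hasDerivAt_line L M) P
  simp only [zero_smul, add_zero] at h
  rw [apply_evalAt, ← dirDeriv_apply]
  exact h.congr_of_eventuallyEq (.of_forall fun z => hP _)

theorem nabla_of_polynomial (hP : ∀ L, H L = SymmetricAlgebra.lift L P)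
    (L : Module.Dual ℂ G) : nabla H L = evalAt L (symD P) :=
  (hasAlgGradientAt_of_polynomial hP L).nabla_eq

theorem nabla_coordFun (X : G) (L : Module.Dual ℂ G) : nabla (coordFun X) L = X :=
  HasAlgGradientAt.nabla_eq fun M => hasDerivAt_line L M X

/-- Polynomial Hamiltonians in involution satisfy the zero-curvature equation. -/
theorem zeroCurvatureAt_of_poisson_eq_zero (hP₁ : ∀ L, H₁ L = SymmetricAlgebra.lift L P₁)
    (hP₂ : ∀ L, H₂ L = SymmetricAlgebra.lift L P₂) (hcomm : ∀ L, poisson H₁ H₂ L = 0)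
    (L : Module.Dual ℂ G) : ZeroCurvatureAt H₁ H₂ L := by
  have h₁ := nabla_of_polynomial hP₁
  have h₂ := nabla_of_polynomial hP₂
  -- `δ X` is the velocity at `L` of a flow whose Hamiltonian has gradient `X` there.
  let δ (X : G) : Module.Dual ℂ G := -(L ∘ₗ (LieAlgebra.ad ℂ G X : G →ₗ[ℂ] G))
  have hδ (X Y : G) : δ X Y = L ⁅Y, X⁆ := by
    change -(L ⁅X, Y⁆) = _
    rw [← map_neg, lie_skew]
  have key {H H' : Module.Dual ℂ G → ℂ} {P : SymmetricAlgebra ℂ G}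
      (h : ∀ L, nabla H L = evalAt L (symD P)) :
      HasFlowDerivAt H' (nabla H) L (evalDeriv L (δ (nabla H' L)) (symD P)) := by
    intro γ t hγ hflow M
    subst hγ
    simp only [h]
    refine hasDerivAt_apply_evalAt (fun X => ?_) _ M
    rw [hδ]
    exact hflow X
  refine ⟨_, _, key h₁, key h₂, ?_⟩
  rw [← Module.forall_dual_apply_eq_zero_iff ℂ]
  intro M
  -- Differentiating the involution identity along the line `L + z • M`; the identity is needed at
  -- all points, not only at `L`.
  have hd := hasDerivAt_lie (γ := fun z : ℂ => L + z • M) (hasDerivAt_line L M) (symD P₁) (symD P₂)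
  simp only [zero_smul, add_zero] at hd
  have h0 : (fun z : ℂ => (L + z • M) ⁅evalAt (L + z • M) (symD P₁), evalAt (L + z • M) (symD P₂)⁆)
      = fun _ => 0 := by
    funext z
    rw [← h₁, ← h₂]
    exact hcomm _
  rw [h0] at hd
  have h := hd.unique (hasDerivAt_const (0 : ℂ) (0 : ℂ))
  have hskew : L ⁅evalAt L (symD P₁), evalDeriv L M (symD P₂)⁆ =
      -(L ⁅evalDeriv L M (symD P₂), evalAt L (symD P₁)⁆) := by
    rw [← map_neg, lie_skew]
  -- Symmetry of the second derivatives exchanges the direction `M` with the flow velocity, turning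
  -- `M` of a time derivative into a term of `h`.
  rw [map_add, map_sub, evalDeriv_symD_comm, evalDeriv_symD_comm _ _ M, hδ, hδ, h₁, h₂]
  linear_combination h - hskew

end PolynomialHamiltonian

/-! ### Invariants evaluated on power series -/

section PowerSeriesGradient

variable {V W : Type*} [AddCommGroup V] [Module ℂ V] [AddCommGroup W] [Module ℂ W]

/-- The `k`-th coefficient of the gradient of a polynomial at a `V^*`-valued power series: the map
`P ⊗ v ↦ (coefficient k of P(ξ)) v`. -/
noncomputable def gradCoeff (ξ : V →ₗ[ℂ] PowerSeries ℂ) (k : ℕ) :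
    SymmetricAlgebra ℂ V ⊗[ℂ] V →ₗ[ℂ] V :=
  TensorProduct.lift (LinearMap.lsmul ℂ V ∘ₗ PowerSeries.coeff k ∘ₗ
    (SymmetricAlgebra.lift ξ).toLinearMap)

@[simp] theorem gradCoeff_tmul (ξ : V →ₗ[ℂ] PowerSeries ℂ) (k : ℕ) (P : SymmetricAlgebra ℂ V)
    (v : V) :
    gradCoeff ξ k (P ⊗ₜ v) = PowerSeries.coeff k (SymmetricAlgebra.lift ξ P) • v := by
  simp [gradCoeff]

theorem coeff_contr (ξ η : V →ₗ[ℂ] PowerSeries ℂ) (n : ℕ) (T : SymmetricAlgebra ℂ V ⊗[ℂ] V) :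
    PowerSeries.coeff n (contr ξ η T) =
      ∑ p ∈ Finset.HasAntidiagonal.antidiagonal n, PowerSeries.coeff p.2 (η (gradCoeff ξ p.1 T)) := by
  induction T with
  | zero => simp
  | tmul P v => simp [PowerSeries.coeff_mul]
  | add S T hS hT => simp only [map_add, hS, hT, Finset.sum_add_distrib]

/-- The chain rule for the coefficients of a polynomial evaluated on a power series. -/
theorem dirDeriv_coeff_lift (Ξ : V →ₗ[ℂ] PowerSeries (SymmetricAlgebra ℂ W))
    (L θ : W →ₗ[ℂ] ℂ) (ξ η : V →ₗ[ℂ] PowerSeries ℂ)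
    (hξ : ∀ I n, PowerSeries.coeff n (SymmetricAlgebra.lift ξ I) =
      SymmetricAlgebra.lift L (PowerSeries.coeff n (SymmetricAlgebra.lift Ξ I)))
    (hη : ∀ x n, PowerSeries.coeff n (η x) = dirDeriv L θ (PowerSeries.coeff n (Ξ x)))
    (I : SymmetricAlgebra ℂ V) (n : ℕ) :
    dirDeriv L θ (PowerSeries.coeff n (SymmetricAlgebra.lift Ξ I)) =
      PowerSeries.coeff n (contr ξ η (symD I)) := by
  induction I using SymmetricAlgebra.induction generalizing n with
  | algebraMap r =>
    rw [AlgHom.commutes, symD_algebraMap, map_zero, map_zero, PowerSeries.algebraMap_apply,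
      PowerSeries.coeff_C]
    split_ifs with h
    · rw [dirDeriv_apply, symD_algebraMap, map_zero]
    · rw [map_zero]
  | ι x => simp [hη]
  | mul P Q hP hQ =>
    simp only [map_mul, symD_mul, map_add, contr_smul, PowerSeries.coeff_mul, map_sum,
      dirDeriv_mul, hP, hQ, hξ, Finset.sum_add_distrib]
    -- The two halves of the Leibniz rule enumerate the antidiagonal in opposite orders; the swap
    -- matches them.
    congr 1
    rw [← Finset.Nat.sum_antidiagonal_swap]
    simp
  | add P Q hP hQ => simp only [map_add, symD_add, hP, hQ]

end PowerSeriesGradient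

/-! ### Coadjoint invariance over an arbitrary commutative algebra. -/

section Invariance

variable {𝔤 : Type*} [LieRing 𝔤] [LieAlgebra ℂ 𝔤]

theorem fst_symAd (x : 𝔤) (I : SymmetricAlgebra ℂ 𝔤) : (symAd x I).fst = I := by
  have h : (TrivSqZeroExt.fstHom ℂ (SymmetricAlgebra ℂ 𝔤)
      (SymmetricAlgebra ℂ 𝔤)).comp (symAd x) = AlgHom.id ℂ _ := by
    ext v
    simp [symAd]
  exact congrArg (fun f : SymmetricAlgebra ℂ 𝔤 →ₐ[ℂ] SymmetricAlgebra ℂ 𝔤 => f I) h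

theorem snd_symAd (x : 𝔤) (I : SymmetricAlgebra ℂ 𝔤) :
    (symAd x I).snd = contr (SymmetricAlgebra.ι ℂ 𝔤)
      (SymmetricAlgebra.ι ℂ 𝔤 ∘ₗ (LieAlgebra.ad ℂ 𝔤 x : 𝔤 →ₗ[ℂ] 𝔤)) (symD I) := by
  induction I using SymmetricAlgebra.induction with
  | algebraMap r =>
    rw [AlgHom.commutes, symD_algebraMap, map_zero]
    rfl
  | ι y => simp [symAd]
  | mul P Q hP hQ => simp [fst_symAd, hP, hQ, mul_comm]
  | add P Q hP hQ => simp [hP, hQ]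

/-- Invariance is an identity in the symmetric algebra; applying the algebra map
`SymmetricAlgebra.lift ξ` specializes it to any point `ξ`. -/
theorem IsCoadjointInvariant.contr_eq_zero {I : SymmetricAlgebra ℂ 𝔤}
    (hI : IsCoadjointInvariant I) {A : Type*} [CommRing A] [Algebra ℂ A] (ξ : 𝔤 →ₗ[ℂ] A) (x : 𝔤) :
    contr ξ (ξ ∘ₗ (LieAlgebra.ad ℂ 𝔤 x : 𝔤 →ₗ[ℂ] 𝔤)) (symD I) = 0 := by
  have h := congrArg (SymmetricAlgebra.lift ξ) ((snd_symAd x I).symm.trans (hI x))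
  have hι : (SymmetricAlgebra.lift ξ).toLinearMap ∘ₗ SymmetricAlgebra.ι ℂ 𝔤 = ξ :=
    SymmetricAlgebra.lift_comp_ι ξ
  rwa [algHom_contr, map_zero, ← LinearMap.comp_assoc, hι] at h

/-- The gradient of an invariant at a power series centralizes the series. -/
theorem IsCoadjointInvariant.sum_coeff_lie_eq_zero {I : SymmetricAlgebra ℂ 𝔤}
    (hI : IsCoadjointInvariant I) (ξ : 𝔤 →ₗ[ℂ] PowerSeries ℂ) (x : 𝔤) (n : ℕ) :
    ∑ k ∈ Finset.range (n + 1),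
      PowerSeries.coeff (n - k) (ξ ⁅x, gradCoeff ξ k (symD I)⁆) = 0 := by
  have h := congrArg (PowerSeries.coeff n) (hI.contr_eq_zero ξ x)
  rw [coeff_contr, map_zero, Finset.Nat.sum_antidiagonal_eq_sum_range_succ_mk] at h
  exact h

end Invariance

/-! ### Homogeneous twisted loops -/

section Homogeneous

variable {𝔤 : Type*} [LieRing 𝔤] [LieAlgebra ℂ 𝔤] (σ : 𝔤 ≃ₗ⁅ℂ⁆ 𝔤)

/-- The map `π_j = (1 + (-1)^j σ) / 2`. -/
noncomputable def parityProj (j : ℤ) : 𝔤 →ₗ[ℂ] 𝔤 :=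
  (1 / 2 : ℂ) • (LinearMap.id + (-1 : ℂ) ^ j • (σ : 𝔤 →ₗ[ℂ] 𝔤))

theorem parityProj_apply (j : ℤ) (x : 𝔤) :
    parityProj σ j x = (1 / 2 : ℂ) • (x + (-1 : ℂ) ^ j • σ x) := rfl

theorem parityProj_of_mem {j : ℤ} {x : 𝔤} (hx : σ x = (-1 : ℂ) ^ j • x) :
    parityProj σ j x = x := by
  rw [parityProj_apply, hx, smul_smul, ← mul_zpow, neg_one_mul, neg_neg, one_zpow, one_smul,
    ← two_smul ℂ x, smul_smul]
  norm_num

variable (hσ : ∀ x, σ (σ x) = x)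

include hσ in
theorem map_parityProj (j : ℤ) (x : 𝔤) :
    σ (parityProj σ j x) = (-1 : ℂ) ^ j • parityProj σ j x := by
  have h1 : (-1 : ℂ) ^ j * (-1 : ℂ) ^ j = 1 := by
    rw [← mul_zpow, neg_one_mul, neg_neg, one_zpow]
  rw [parityProj_apply, map_smul, map_add, map_smul, hσ, smul_comm ((-1 : ℂ) ^ j) (1 / 2 : ℂ),
    smul_add ((-1 : ℂ) ^ j), smul_smul ((-1 : ℂ) ^ j), h1, one_smul, add_comm]

theorem parityProj_lie {i : ℤ} (j : ℤ) {x : 𝔤} (hx : σ x = (-1 : ℂ) ^ i • x) (y : 𝔤) :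
    parityProj σ (i + j) ⁅x, y⁆ = ⁅x, parityProj σ j y⁆ := by
  have h1 : (-1 : ℂ) ^ i * (-1 : ℂ) ^ i = 1 := by
    rw [← mul_zpow, neg_one_mul, neg_neg, one_zpow]
  rw [parityProj_apply, parityProj_apply, LieEquiv.map_lie, hx, smul_lie, smul_smul,
    zpow_add₀ (by norm_num : (-1 : ℂ) ≠ 0), mul_right_comm, h1, one_mul, lie_smul, lie_add,
    lie_smul]

theorem coe_twistedMono (j : ℤ) (x : 𝔤) :
    (twistedMono σ hσ j x : LieAlgebra.loopAlgebra ℂ ℤ 𝔤) = loopMono j (parityProj σ j x) := rfl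

/-- Once one factor is projected, the projection of the other is absorbed by the projection of the
bracket. Gradient coefficients can therefore stay in `𝔤`. -/
theorem lie_twistedMono (i j : ℤ) (x y : 𝔤) :
    ⁅twistedMono σ hσ i x, twistedMono σ hσ j y⁆ =
      twistedMono σ hσ (i + j) ⁅parityProj σ i x, y⁆ := by
  apply Subtype.ext
  rw [LieSubalgebra.coe_bracket, coe_twistedMono, coe_twistedMono, coe_twistedMono, loopMono_lie,
    parityProj_lie σ j (map_parityProj σ hσ i x)]

theorem twistedMono_induction {p : twistedLoop σ → Prop} (X : twistedLoop σ) (h0 : p 0)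
    (hadd : ∀ X Y, p X → p Y → p (X + Y)) (hmono : ∀ j x, p (twistedMono σ hσ j x)) : p X := by
  have hX : X = ∑ j ∈ (LieAlgebra.LoopAlgebra.toFinsupp ℂ ℤ 𝔤 X).support,
      twistedMono σ hσ j (loopCoeff j (X : LieAlgebra.loopAlgebra ℂ ℤ 𝔤)) := by
    apply Subtype.ext
    rw [AddSubmonoidClass.coe_finsetSum]
    conv_lhs => rw [← sum_loopMono (X : LieAlgebra.loopAlgebra ℂ ℤ 𝔤)]
    refine Finset.sum_congr rfl fun j _ => ?_
    rw [coe_twistedMono, parityProj_of_mem σ (X.2 j)]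
    rfl
  rw [hX]
  exact Finset.sum_induction _ p hadd h0 fun j _ => hmono j _

/-- The projection of `𝔤` onto `𝔤_0`. -/
noncomputable def fixedProj : 𝔤 →ₗ[ℂ] fixedSubalgebra σ :=
  LinearMap.codRestrict (fixedSubalgebra σ).toSubmodule (parityProj σ 0) fun x => by
    have h := map_parityProj σ hσ 0 x
    rw [zpow_zero, one_smul] at h
    exact h

theorem fixedProj_coe (x : fixedSubalgebra σ) : fixedProj σ hσ (x : 𝔤) = x := by
  apply Subtype.ext
  have h : σ (x : 𝔤) = x := x.2
  exact parityProj_of_mem σ (by simpa using h)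

theorem twistedMono_zero (x : 𝔤) :
    twistedMono σ hσ 0 x = constLoop σ (fixedProj σ hσ x) := rfl

theorem constLoop_eq (x : fixedSubalgebra σ) : constLoop σ x = twistedMono σ hσ 0 x := by
  rw [twistedMono_zero, fixedProj_coe]

theorem constLoop_lie (x y : fixedSubalgebra σ) :
    constLoop σ ⁅x, y⁆ = ⁅constLoop σ x, constLoop σ y⁆ := by
  apply Subtype.ext
  exact ((loopMono_lie 0 0 (x : 𝔤) (y : 𝔤)).trans rfl).symm

theorem truncate_twistedMono (p : ℤ → Prop) [DecidablePred p] (j : ℤ) (x : 𝔤) :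
    truncate σ p (twistedMono σ hσ j x) = if p j then twistedMono σ hσ j x else 0 := by
  have h (y : 𝔤) : LieAlgebra.LoopAlgebra.toFinsupp ℂ ℤ 𝔤 (loopMono j y) =
      Finsupp.single j y :=
    LieAlgebra.LoopAlgebra.toFinsupp_single_tmul ..
  apply Subtype.ext
  change (LieAlgebra.LoopAlgebra.toFinsupp ℂ ℤ 𝔤).symm (Finsupp.filter p
    (LieAlgebra.LoopAlgebra.toFinsupp ℂ ℤ 𝔤 (loopMono j (parityProj σ j x)))) = _
  rw [h]
  split_ifs with hp
  · rw [Finsupp.filter_single_of_pos _ hp, ← h, LinearEquiv.symm_apply_apply, coe_twistedMono]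
  · rw [Finsupp.filter_single_of_neg _ hp, map_zero]
    rfl

theorem zeroCoeff_twistedMono (j : ℤ) (x : 𝔤) :
    zeroCoeff σ (twistedMono σ hσ j x) = if j = 0 then fixedProj σ hσ x else 0 := by
  apply Subtype.ext
  change loopCoeff 0 (loopMono j (parityProj σ j x)) = _
  rw [loopCoeff_loopMono]
  split_ifs with h
  · subst h
    rfl
  · rfl

variable (R₀ : fixedSubalgebra σ →ₗ[ℂ] fixedSubalgebra σ)

theorem triangularR_of_pos {j : ℤ} (hj : 0 < j) (x : 𝔤) :
    triangularR σ R₀ (twistedMono σ hσ j x) = twistedMono σ hσ j x := by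
  simp [triangularR, truncate_twistedMono, zeroCoeff_twistedMono, hj, hj.ne', hj.le]

theorem triangularR_of_neg {j : ℤ} (hj : j < 0) (x : 𝔤) :
    triangularR σ R₀ (twistedMono σ hσ j x) = -twistedMono σ hσ j x := by
  simp [triangularR, truncate_twistedMono, zeroCoeff_twistedMono, hj, hj.ne, hj.le]

include hσ in
theorem triangularR_constLoop (x : fixedSubalgebra σ) :
    triangularR σ R₀ (constLoop σ x) = constLoop σ (R₀ x) := by
  rw [constLoop_eq σ hσ]
  simp [triangularR, truncate_twistedMono, zeroCoeff_twistedMono, fixedProj_coe]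

theorem triangularR_zero (x : 𝔤) :
    triangularR σ R₀ (twistedMono σ hσ 0 x) = twistedMono σ hσ 0 (R₀ (fixedProj σ hσ x) : 𝔤) := by
  rw [twistedMono_zero, triangularR_constLoop σ hσ, constLoop_eq σ hσ]

-- By bilinearity it suffices to treat homogeneous loops. In nonzero degrees the operator is the
-- scalar `±1`; with just one degree zero, the terms containing `R₀` cancel. Only degrees `(0, 0)`
-- use the equation for `R₀`.
include hσ in
theorem isROperator_triangularR (hR₀ : IsROperator R₀) : IsROperator (triangularR σ R₀) := by
  intro X Y
  induction X using twistedMono_induction σ hσ with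
  | h0 => simp
  | hadd X X' hX hX' =>
    rw [add_lie X X' Y, ← hX, ← hX']
    simp only [map_add, add_lie]
    abel
  | hmono i x =>
  induction Y using twistedMono_induction σ hσ with
  | h0 => simp
  | hadd Y Y' hY hY' =>
    rw [lie_add (twistedMono σ hσ i x) Y Y', ← hY, ← hY']
    simp only [map_add, lie_add]
    abel
  | hmono j y =>
  rcases lt_trichotomy i 0 with hi | rfl | hi <;> rcases lt_trichotomy j 0 with hj | rfl | hj
  · simp only [triangularR_of_neg σ hσ R₀ hi, triangularR_of_neg σ hσ R₀ hj, neg_lie, lie_neg,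
      map_add, map_neg, lie_twistedMono, triangularR_of_neg σ hσ R₀ (add_neg hi hj)]
    abel
  · simp only [triangularR_zero, neg_lie, map_add, map_neg,
      lie_twistedMono, add_zero, triangularR_of_neg σ hσ R₀ hi]
    abel
  · simp only [triangularR_of_neg σ hσ R₀ hi, triangularR_of_pos σ hσ R₀ hj, neg_lie,
      neg_add_cancel, map_zero]
    abel
  · simp only [triangularR_zero, lie_neg, map_add, map_neg,
      lie_twistedMono, zero_add, triangularR_of_neg σ hσ R₀ hj]
    abel
  · simp only [twistedMono_zero, triangularR_constLoop σ hσ, ← constLoop_lie, ← map_add,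
      ← map_sub, hR₀ _ _]
  · simp only [triangularR_zero, map_add,
      lie_twistedMono, zero_add, triangularR_of_pos σ hσ R₀ hj]
    abel
  · simp only [triangularR_of_neg σ hσ R₀ hj, triangularR_of_pos σ hσ R₀ hi, lie_neg,
      add_neg_cancel, map_zero]
    abel
  · simp only [triangularR_zero, map_add,
      lie_twistedMono, add_zero, triangularR_of_pos σ hσ R₀ hi]
    abel
  · simp only [triangularR_of_pos σ hσ R₀ hi, triangularR_of_pos σ hσ R₀ hj,
      map_add, lie_twistedMono, triangularR_of_pos σ hσ R₀ (add_pos hi hj)]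
    abel

include hσ in
/-- If `R₀` commutes with the adjoint action, then the triangular operator commutes with the
adjoint action of the constant loops. -/
theorem triangularR_lie_constLoop (hR₀ : ∀ x y : fixedSubalgebra σ, R₀ ⁅x, y⁆ = ⁅x, R₀ y⁆) (x : fixedSubalgebra σ)
    (Y : twistedLoop σ) :
    triangularR σ R₀ ⁅constLoop σ x, Y⁆ = ⁅constLoop σ x, triangularR σ R₀ Y⁆ := by
  induction Y using twistedMono_induction σ hσ with
  | h0 => simp
  | hadd Y Y' hY hY' => rw [lie_add, map_add, map_add, lie_add, hY, hY']
  | hmono j y =>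
  rcases lt_trichotomy j 0 with hj | rfl | hj
  · rw [triangularR_of_neg σ hσ R₀ hj, constLoop_eq σ hσ, lie_neg, lie_twistedMono, zero_add,
      triangularR_of_neg σ hσ R₀ hj]
  · rw [twistedMono_zero, ← constLoop_lie, triangularR_constLoop σ hσ, triangularR_constLoop σ hσ,
      hR₀, constLoop_lie]
  · rw [triangularR_of_pos σ hσ R₀ hj, constLoop_eq σ hσ, lie_twistedMono, zero_add,
      triangularR_of_pos σ hσ R₀ hj]

end Homogeneous

/-! ### Reductive Lie algebras -/

section Reductive

open LieAlgebra

variable {k 𝔞 : Type*} [Field k] [LieRing 𝔞] [LieAlgebra k 𝔞]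

/-- The preimage of an abelian ideal has its derived ideal in the center, so it is solvable and lies
in the radical, which is the center. -/
theorem hasTrivialRadical_quotient_center [FiniteDimensional k 𝔞] [HasCentralRadical k 𝔞] :
    HasTrivialRadical k (𝔞 ⧸ center k 𝔞) := by
  rw [hasTrivialRadical_iff_no_abelian_ideals]
  intro J hJ
  let π : 𝔞 →ₗ⁅k⁆ 𝔞 ⧸ center k 𝔞 :=
    { toLinearMap := (LieSubmodule.Quotient.mk' (center k 𝔞) : 𝔞 →ₗ[k] 𝔞 ⧸ center k 𝔞)
      map_lie' := rfl }
  have hπ (x : 𝔞) : π x = 0 ↔ x ∈ center k 𝔞 := LieSubmodule.Quotient.mk_eq_zero'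
  let J' : LieIdeal k 𝔞 := LieIdeal.comap π J
  have h1 : ⁅J', J'⁆ ≤ center k 𝔞 := by
    rw [LieSubmodule.lieIdeal_oper_eq_span, LieSubmodule.lieSpan_le]
    rintro _ ⟨x, y, rfl⟩
    have hx : π x ∈ J := x.2
    have hy : π y ∈ J := y.2
    change ⁅(x : 𝔞), (y : 𝔞)⁆ ∈ center k 𝔞
    rw [← hπ, LieHom.map_lie]
    exact congrArg Subtype.val (hJ.trivial ⟨π x, hx⟩ ⟨π y, hy⟩)
  have h2 : IsSolvable J' := by
    refine IsSolvable.mk (R := k) (k := 2) ((LieIdeal.derivedSeries_eq_bot_iff J' 2).mpr ?_)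
    rw [derivedSeriesOfIdeal_succ, derivedSeriesOfIdeal_succ, derivedSeriesOfIdeal_zero]
    refine le_bot_iff.mp ((LieSubmodule.mono_lie h1 h1).trans ?_)
    rw [LieSubmodule.lieIdeal_oper_eq_span, LieSubmodule.lieSpan_le]
    rintro _ ⟨x, y, rfl⟩
    exact (LieModule.mem_maxTrivSubmodule k 𝔞 𝔞 _).mp y.2 x
  have h3 : J' ≤ center k 𝔞 := by
    rw [← HasCentralRadical.radical_eq_center]
    exact (LieIdeal.solvable_iff_le_radical k 𝔞 J').mp h2
  rw [LieSubmodule.eq_bot_iff]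
  intro z hz
  obtain ⟨x, rfl⟩ := LieSubmodule.Quotient.surjective_mk' (center k 𝔞) z
  exact (hπ x).mpr (h3 hz)

/-- For a Lie algebra with nondegenerate Killing form, every 2-cocycle with trivial coefficients is
a coboundary. -/
theorem exists_cocycle_eq [FiniteDimensional k 𝔞] [IsKilling k 𝔞] (ω : 𝔞 →ₗ[k] 𝔞 →ₗ[k] k)
    (hskew : ∀ x y, ω x y = -ω y x)
    (hω : ∀ x y z, ω ⁅x, y⁆ z + ω ⁅y, z⁆ x + ω ⁅z, x⁆ y = 0) :
    ∃ f : Module.Dual k 𝔞, ∀ x y, ω x y = f ⁅x, y⁆ := by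
  have hnd := IsKilling.killingForm_nondegenerate k 𝔞
  let e := (killingForm k 𝔞).toDual hnd
  have he (g : Module.Dual k 𝔞) (y : 𝔞) : killingForm k 𝔞 (e.symm g) y = g y :=
    LinearMap.BilinForm.apply_toDual_symm_apply ..
  have hinj {x y : 𝔞} (h : ∀ z, killingForm k 𝔞 x z = killingForm k 𝔞 y z) : x = y :=
    e.injective (LinearMap.ext h)
  have hinv (x y z : 𝔞) : killingForm k 𝔞 ⁅x, y⁆ z = killingForm k 𝔞 x ⁅y, z⁆ :=
    LieModule.traceForm_apply_lie_apply k 𝔞 𝔞 x y z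
  -- Through the Killing form, the cocycle identity becomes the Leibniz rule; the derivation is then
  -- inner, `ad h`, and `f` is the Killing form paired with `h`.
  have hleib (a b : 𝔞) : e.symm (ω ⁅a, b⁆) = ⁅a, e.symm (ω b)⁆ - ⁅b, e.symm (ω a)⁆ := by
    apply hinj
    intro z
    rw [map_sub, LinearMap.sub_apply, ← lie_skew a (e.symm (ω b)), ← lie_skew b (e.symm (ω a)),
      map_neg, map_neg, LinearMap.neg_apply, LinearMap.neg_apply, hinv, hinv, he, he, he]
    have h := hω a b z
    rw [hskew ⁅b, z⁆ a, hskew ⁅z, a⁆ b, ← lie_skew z a, map_neg] at h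
    linear_combination h
  obtain ⟨D, hD⟩ : ∃ D : LieDerivation k 𝔞 𝔞, ∀ x, D x = e.symm (ω x) :=
    ⟨⟨e.symm.toLinearMap ∘ₗ ω, hleib⟩, fun _ => rfl⟩
  obtain ⟨h, rfl⟩ := LieDerivation.IsKilling.exists_eq_ad D
  refine ⟨killingForm k 𝔞 h, fun x y => ?_⟩
  rw [← hinv, ← he (ω x) y, ← hD, LieDerivation.ad_apply_apply]

/-- Any linear extension `g` of `c` defines the cocycle `g ⁅x, y⁆` on the semisimple quotient by the
center. It is a coboundary of some `f`, and subtracting the pullback of `f` kills all brackets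
without changing the values on the center. -/
theorem exists_dual_center_extension [CharZero k] [FiniteDimensional k 𝔞] [HasCentralRadical k 𝔞]
    (c : Module.Dual k (center k 𝔞)) :
    ∃ κ : Module.Dual k 𝔞, (∀ z : center k 𝔞, κ z = c z) ∧ ∀ x y : 𝔞, κ ⁅x, y⁆ = 0 := by
  have := hasTrivialRadical_quotient_center (k := k) (𝔞 := 𝔞)
  obtain ⟨g, hg⟩ := LinearMap.exists_extend (p := (center k 𝔞).toSubmodule) c
  have hc {x : 𝔞} (hx : x ∈ center k 𝔞) (y : 𝔞) : ⁅y, x⁆ = 0 :=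
    (LieModule.mem_maxTrivSubmodule k 𝔞 𝔞 _).mp hx y
  let ω : 𝔞 →ₗ[k] 𝔞 →ₗ[k] k := (LieModule.toEnd k 𝔞 𝔞 : 𝔞 →ₗ[k] 𝔞 →ₗ[k] 𝔞).compr₂ g
  have hω (x y : 𝔞) : ω x y = g ⁅x, y⁆ := rfl
  let ω₁ : 𝔞 →ₗ[k] (𝔞 ⧸ (center k 𝔞).toSubmodule) →ₗ[k] k :=
    { toFun x := (center k 𝔞).toSubmodule.liftQ (ω x) fun y hy => by
        rw [LinearMap.mem_ker, hω, hc hy, map_zero]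
      map_add' x y := by ext; simp
      map_smul' a x := by ext; simp }
  let ω₂ : (𝔞 ⧸ center k 𝔞) →ₗ[k] (𝔞 ⧸ center k 𝔞) →ₗ[k] k :=
    (center k 𝔞).toSubmodule.liftQ ω₁ fun x hx => by
      rw [LinearMap.mem_ker]
      refine LinearMap.ext fun y => ?_
      obtain ⟨y, rfl⟩ := LieSubmodule.Quotient.surjective_mk' (center k 𝔞) y
      change g ⁅x, y⁆ = 0
      rw [← lie_skew, hc hx, neg_zero, map_zero]
  have hω₂ (x y : 𝔞) : ω₂ (LieSubmodule.Quotient.mk x) (LieSubmodule.Quotient.mk y) = g ⁅x, y⁆ :=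
    rfl
  have hsurj := LieSubmodule.Quotient.surjective_mk' (center k 𝔞)
  obtain ⟨f, hf⟩ := exists_cocycle_eq ω₂
    (by
      intro x y
      obtain ⟨x, rfl⟩ := hsurj x
      obtain ⟨y, rfl⟩ := hsurj y
      change g ⁅x, y⁆ = -g ⁅y, x⁆
      rw [← map_neg, lie_skew])
    (by
      intro x y z
      obtain ⟨x, rfl⟩ := hsurj x
      obtain ⟨y, rfl⟩ := hsurj y
      obtain ⟨z, rfl⟩ := hsurj z
      change g ⁅⁅x, y⁆, z⁆ + g ⁅⁅y, z⁆, x⁆ + g ⁅⁅z, x⁆, y⁆ = 0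
      have h := congrArg g (lie_jacobi x y z)
      rw [map_add, map_add, map_zero] at h
      rw [← lie_skew ⁅x, y⁆ z, ← lie_skew ⁅y, z⁆ x, ← lie_skew ⁅z, x⁆ y, map_neg, map_neg, map_neg]
      linear_combination -h)
  refine ⟨g - f ∘ₗ (center k 𝔞).toSubmodule.mkQ, fun z => ?_, fun x y => ?_⟩
  · have hz : (center k 𝔞).toSubmodule.mkQ (z : 𝔞) = 0 :=
      (Submodule.Quotient.mk_eq_zero _).mpr z.2
    rw [LinearMap.sub_apply, LinearMap.comp_apply, hz, map_zero, sub_zero, ← hg]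
    rfl
  · have h := hf (LieSubmodule.Quotient.mk x) (LieSubmodule.Quotient.mk y)
    rw [hω₂, ← LieSubmodule.Quotient.mk_bracket] at h
    rw [LinearMap.sub_apply, h]
    exact sub_self _

/-- Represent `f` by a vector `h` via the Killing form: vanishing on brackets makes `h` central,
hence zero. -/
theorem dual_eq_zero_of_lie_eq_zero [FiniteDimensional k 𝔞] [IsKilling k 𝔞]
    (f : Module.Dual k 𝔞) (hf : ∀ x y : 𝔞, f ⁅x, y⁆ = 0) : f = 0 := by
  have hnd := IsKilling.killingForm_nondegenerate k 𝔞
  obtain ⟨h, rfl⟩ := ((killingForm k 𝔞).toDual hnd).surjective f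
  have h0 : h ∈ center k 𝔞 := by
    rw [LieModule.mem_maxTrivSubmodule]
    intro x
    apply ((killingForm k 𝔞).toDual hnd).injective
    ext y
    rw [map_zero, ← lie_skew, map_neg, LinearMap.neg_apply]
    exact neg_eq_zero.mpr ((LieModule.traceForm_apply_lie_apply k 𝔞 𝔞 h x y).trans (hf x y))
  rw [center_eq_bot, LieSubmodule.mem_bot] at h0
  rw [h0, map_zero]

/-- A reductive Lie algebra is the sum of its center and its derived algebra, in dual form. -/
theorem dual_ext_of_reductive [CharZero k] [FiniteDimensional k 𝔞] [HasCentralRadical k 𝔞]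
    (f : Module.Dual k 𝔞) (hz : ∀ z ∈ center k 𝔞, f z = 0) (hf : ∀ x y : 𝔞, f ⁅x, y⁆ = 0) :
    f = 0 := by
  have := hasTrivialRadical_quotient_center (k := k) (𝔞 := 𝔞)
  let F : Module.Dual k (𝔞 ⧸ center k 𝔞) := (center k 𝔞).toSubmodule.liftQ f hz
  have hF : F = 0 := by
    apply dual_eq_zero_of_lie_eq_zero
    intro x y
    obtain ⟨x, rfl⟩ := LieSubmodule.Quotient.surjective_mk' (center k 𝔞) x
    obtain ⟨y, rfl⟩ := LieSubmodule.Quotient.surjective_mk' (center k 𝔞) y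
    exact hf x y
  ext x
  exact congrArg (fun F : Module.Dual k (𝔞 ⧸ center k 𝔞) => F (LieSubmodule.Quotient.mk x)) hF

end Reductive

/-! ### The R-operator of a splitting -/

section SplitOperator

variable {𝔥 : Type*} [LieRing 𝔥] [LieAlgebra ℂ 𝔥] (𝔞 𝔟 : LieIdeal ℂ 𝔥) (h : IsCompl 𝔞 𝔟)

theorem idealProj_mem (x : 𝔥) : idealProj 𝔞 𝔟 h x ∈ 𝔞 :=
  Submodule.projection_apply_mem _ x

theorem idealProj_add (x : 𝔥) : idealProj 𝔞 𝔟 h x + idealProj 𝔟 𝔞 h.symm x = x :=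
  Submodule.projection_add_projection_eq_self _ x

theorem idealProj_of_mem {x : 𝔥} (hx : x ∈ 𝔞) : idealProj 𝔞 𝔟 h x = x :=
  Submodule.projection_apply_left _ (⟨x, hx⟩ : 𝔞.toSubmodule)

theorem idealProj_of_mem_right {x : 𝔥} (hx : x ∈ 𝔟) : idealProj 𝔞 𝔟 h x = 0 :=
  (Submodule.projection_apply_eq_zero_iff _).mpr hx

theorem idealProj_lie (x y : 𝔥) : idealProj 𝔞 𝔟 h ⁅x, y⁆ = ⁅x, idealProj 𝔞 𝔟 h y⁆ := by
  conv_lhs => rw [← idealProj_add 𝔞 𝔟 h y, lie_add, map_add,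
    idealProj_of_mem _ _ h (lie_mem_right ℂ 𝔥 𝔞 x _ (idealProj_mem 𝔞 𝔟 h y)),
    idealProj_of_mem_right _ _ h (lie_mem_right ℂ 𝔥 𝔟 x _ (idealProj_mem 𝔟 𝔞 h.symm y)), add_zero]

theorem splitR_lie (x y : 𝔥) : splitR 𝔞 𝔟 h ⁅x, y⁆ = ⁅x, splitR 𝔞 𝔟 h y⁆ := by
  simp [splitR, idealProj_lie]

theorem splitR_splitR (x : 𝔥) : splitR 𝔞 𝔟 h (splitR 𝔞 𝔟 h x) = x := by
  have h1 := idealProj_mem 𝔞 𝔟 h x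
  have h2 := idealProj_mem 𝔟 𝔞 h.symm x
  simp only [splitR, LinearMap.sub_apply, map_sub, idealProj_of_mem 𝔞 𝔟 h h1,
    idealProj_of_mem 𝔟 𝔞 h.symm h2, idealProj_of_mem_right 𝔞 𝔟 h h2,
    idealProj_of_mem_right 𝔟 𝔞 h.symm h1]
  rw [sub_zero, zero_sub, sub_neg_eq_add, idealProj_add]

/-- `R₀` is an involution commuting with `ad`, so with `R₀² = 1` the left side is `2⁅x, y⁆ - ⁅x,
y⁆`. -/
theorem isROperator_splitR : IsROperator (splitR 𝔞 𝔟 h) := by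
  intro x y
  have hl : ⁅splitR 𝔞 𝔟 h x, y⁆ = splitR 𝔞 𝔟 h ⁅x, y⁆ := by
    rw [← lie_skew, ← splitR_lie, ← map_neg, lie_skew]
  rw [← splitR_lie _ _ _ (splitR 𝔞 𝔟 h x) y, ← splitR_lie, hl, map_add, splitR_splitR,
    add_sub_cancel_right]

theorem rMap_splitR_one : rMap (splitR 𝔞 𝔟 h) 1 = idealProj 𝔞 𝔟 h := by
  ext x
  have hx := idealProj_add 𝔞 𝔟 h x
  simp only [rMap, splitR, LinearMap.smul_apply, LinearMap.add_apply, LinearMap.id_apply,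
    Units.val_one, one_smul, LinearMap.sub_apply]
  nth_rewrite 1 [← hx]
  module

theorem rMap_splitR_neg_one : rMap (splitR 𝔞 𝔟 h) (-1) = idealProj 𝔟 𝔞 h.symm := by
  ext x
  have hx := idealProj_add 𝔞 𝔟 h x
  simp only [rMap, splitR, LinearMap.smul_apply, LinearMap.add_apply, LinearMap.id_apply,
    Units.val_neg, Units.val_one, neg_smul, one_smul, LinearMap.sub_apply, LinearMap.neg_apply]
  nth_rewrite 1 [← hx]
  module

variable {𝔞 𝔟}

theorem IsSumOfCentral.apply_lie_eq_zero {k_a : Module.Dual ℂ (LieAlgebra.center ℂ 𝔞)}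
    {k_b : Module.Dual ℂ (LieAlgebra.center ℂ 𝔟)} {κ : Module.Dual ℂ 𝔥} (h : IsCompl 𝔞 𝔟)
    (hκ : IsSumOfCentral 𝔞 𝔟 k_a k_b κ) (x y : 𝔥) : κ ⁅x, y⁆ = 0 := by
  have hmix {x y : 𝔥} (hx : x ∈ 𝔞) (hy : y ∈ 𝔟) : ⁅x, y⁆ = 0 := by
    have := lie_mem_left ℂ 𝔥 𝔞 x y hx
    rw [← idealProj_of_mem 𝔞 𝔟 h this,
      idealProj_of_mem_right 𝔞 𝔟 h (lie_mem_right ℂ 𝔥 𝔟 x y hy)]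
  have ha := idealProj_mem 𝔞 𝔟 h
  have hb := idealProj_mem 𝔟 𝔞 h.symm
  rw [← idealProj_add 𝔞 𝔟 h x, ← idealProj_add 𝔞 𝔟 h y, add_lie, lie_add, lie_add,
    hmix (ha x) (hb y), ← lie_skew (idealProj 𝔟 𝔞 h.symm x) (idealProj 𝔞 𝔟 h y), hmix (ha y) (hb x), neg_zero, add_zero,
    zero_add, map_add]
  have h1 := hκ.2.1 ⟨_, ha x⟩ ⟨_, ha y⟩
  have h2 := hκ.2.2.2 ⟨_, hb x⟩ ⟨_, hb y⟩
  exact (congrArg₂ (· + ·) h1 h2).trans (add_zero 0)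

theorem existsUnique_isSumOfCentral [FiniteDimensional ℂ 𝔥] [LieAlgebra.HasCentralRadical ℂ 𝔞]
    [LieAlgebra.HasCentralRadical ℂ 𝔟] (h : IsCompl 𝔞 𝔟)
    (k_a : Module.Dual ℂ (LieAlgebra.center ℂ 𝔞)) (k_b : Module.Dual ℂ (LieAlgebra.center ℂ 𝔟)) :
    ∃! κ : Module.Dual ℂ 𝔥, IsSumOfCentral 𝔞 𝔟 k_a k_b κ := by
  have : FiniteDimensional ℂ 𝔞 := inferInstanceAs (FiniteDimensional ℂ 𝔞.toSubmodule)
  have : FiniteDimensional ℂ 𝔟 := inferInstanceAs (FiniteDimensional ℂ 𝔟.toSubmodule)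
  obtain ⟨f, hf, hf'⟩ := exists_dual_center_extension k_a
  obtain ⟨g, hg, hg'⟩ := exists_dual_center_extension k_b
  let pa : 𝔥 →ₗ[ℂ] 𝔞 :=
    LinearMap.codRestrict 𝔞.toSubmodule (idealProj 𝔞 𝔟 h) (idealProj_mem 𝔞 𝔟 h)
  let pb : 𝔥 →ₗ[ℂ] 𝔟 :=
    LinearMap.codRestrict 𝔟.toSubmodule (idealProj 𝔟 𝔞 h.symm) (idealProj_mem 𝔟 𝔞 h.symm)
  let κ : Module.Dual ℂ 𝔥 := f ∘ₗ pa + g ∘ₗ pb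
  have hpa (x : 𝔞) : κ x = f x := by
    have h1 : pa x = x := Subtype.ext (idealProj_of_mem 𝔞 𝔟 h x.2)
    have h2 : pb x = 0 := Subtype.ext (idealProj_of_mem_right 𝔟 𝔞 h.symm x.2)
    change f (pa x) + g (pb x) = _
    rw [h1, h2, map_zero, add_zero]
  have hpb (x : 𝔟) : κ x = g x := by
    have h1 : pa x = 0 := Subtype.ext (idealProj_of_mem_right 𝔞 𝔟 h x.2)
    have h2 : pb x = x := Subtype.ext (idealProj_of_mem 𝔟 𝔞 h.symm x.2)
    change f (pa x) + g (pb x) = _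
    rw [h1, h2, map_zero, zero_add]
  have hκ : IsSumOfCentral 𝔞 𝔟 k_a k_b κ :=
    ⟨fun z => (hpa z).trans (hf z), fun x y => (hpa _).trans (hf' x y),
      fun z => (hpb z).trans (hg z), fun x y => (hpb _).trans (hg' x y)⟩
  refine ⟨κ, hκ, fun κ' hκ' => ?_⟩
  have h1 : (κ' - κ) ∘ₗ 𝔞.toSubmodule.subtype = 0 := by
    refine dual_ext_of_reductive (𝔞 := 𝔞) _ (fun z hz => ?_) fun x y => ?_
    · exact sub_eq_zero.mpr ((hκ'.1 ⟨z, hz⟩).trans (hκ.1 ⟨z, hz⟩).symm)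
    · exact sub_eq_zero.mpr ((hκ'.2.1 x y).trans (hκ.2.1 x y).symm)
  have h2 : (κ' - κ) ∘ₗ 𝔟.toSubmodule.subtype = 0 := by
    refine dual_ext_of_reductive (𝔞 := 𝔟) _ (fun z hz => ?_) fun x y => ?_
    · exact sub_eq_zero.mpr ((hκ'.2.2.1 ⟨z, hz⟩).trans (hκ.2.2.1 ⟨z, hz⟩).symm)
    · exact sub_eq_zero.mpr ((hκ'.2.2.2 x y).trans (hκ.2.2.2 x y).symm)
  rw [← sub_eq_zero]
  ext x
  rw [← idealProj_add 𝔞 𝔟 h x, map_add]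
  exact (congrArg₂ (· + ·) (LinearMap.congr_fun h1 ⟨_, idealProj_mem 𝔞 𝔟 h x⟩)
    (LinearMap.congr_fun h2 ⟨_, idealProj_mem 𝔟 𝔞 h.symm x⟩)).trans (add_zero 0)

end SplitOperator

/-! ### The integrals of the hierarchy -/

section Hierarchy

variable {𝔤 : Type*} [LieRing 𝔤] [LieAlgebra ℂ 𝔤] (σ : 𝔤 ≃ₗ⁅ℂ⁆ 𝔤) (hσ : ∀ x, σ (σ x) = x)

/-- The operator `R + ε`. -/
noncomputable def shift {V : Type*} [AddCommGroup V] [Module ℂ V] (R : V →ₗ[ℂ] V) (ε : ℤˣ) :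
    V →ₗ[ℂ] V :=
  R + (ε : ℤ) • LinearMap.id

theorem shift_apply {V : Type*} [AddCommGroup V] [Module ℂ V] (R : V →ₗ[ℂ] V) (ε : ℤˣ) (x : V) :
    shift R ε x = R x + (ε : ℤ) • x := rfl

/-- The asymmetric form, with `-ε` and not `-ε'` in the last term, is chosen so that `(R - ε)Y` has
no degrees of the sign of `ε`, which suits the gradient in `X`. -/
theorem IsROperator.shift_lie_shift {G : Type*} [LieRing G] [LieAlgebra ℂ G] {R : G →ₗ[ℂ] G}
    (hR : IsROperator R) (ε ε' : ℤˣ) (X Y : G) :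
    ⁅shift R ε X, shift R ε' Y⁆ =
      shift R ε' ⁅shift R ε X, Y⁆ + shift R ε ⁅X, shift R (-ε) Y⁆ := by
  have h := hR X Y
  rw [map_add, sub_eq_iff_eq_add] at h
  have hε : (ε : ℤ) * ε = 1 := Int.units_coe_mul_self ε
  simp only [shift_apply, add_lie, lie_add, map_add, smul_lie, lie_smul, map_zsmul, smul_add,
    Units.val_neg, neg_smul, lie_neg, map_neg, smul_smul, hε, one_smul]
  rw [mul_comm (ε' : ℤ) ε, eq_sub_of_add_eq' h.symm]
  abel

section GeneralR

variable (R : twistedLoop σ →ₗ[ℂ] twistedLoop σ) (ε : ℤˣ) (I : SymmetricAlgebra ℂ 𝔤) (n : ℕ)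
  (L : Module.Dual ℂ (twistedLoop σ))

/-- The `𝔤^*`-valued series of `(R^* + ε) L`. -/
noncomputable def shiftedLax : 𝔤 →ₗ[ℂ] PowerSeries ℂ :=
  laxSeries σ hσ ε (R.dualMap L + (ε : ℤ) • L)

theorem coeff_shiftedLax (x : 𝔤) :
    PowerSeries.coeff n (shiftedLax σ hσ R ε L x) =
      L (shift R ε (twistedMono σ hσ ((ε : ℤ) * n) x)) := by
  simp [shiftedLax, laxSeries, shift_apply]

/-- The series of `(R^* + ε) L` with coefficients in the polynomial functions of `L`. -/
noncomputable def universalLax :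
    𝔤 →ₗ[ℂ] PowerSeries (SymmetricAlgebra ℂ (twistedLoop σ)) where
  toFun x := PowerSeries.mk fun n =>
    SymmetricAlgebra.ι ℂ _ (shift R ε (twistedMono σ hσ ((ε : ℤ) * n) x))
  map_add' x y := by
    ext n
    simp
  map_smul' c x := by
    ext n
    simp

theorem coeff_universalLax (x : 𝔤) :
    PowerSeries.coeff n (universalLax σ hσ R ε x) =
      SymmetricAlgebra.ι ℂ _ (shift R ε (twistedMono σ hσ ((ε : ℤ) * n) x)) := by
  simp [universalLax]

/-- The integral `I^{εn}` as a polynomial. -/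
noncomputable def integralPoly : SymmetricAlgebra ℂ (twistedLoop σ) :=
  PowerSeries.coeff n (SymmetricAlgebra.lift (universalLax σ hσ R ε) I)

theorem integral_eq :
    integral σ hσ R ε I n L = SymmetricAlgebra.lift L (integralPoly σ hσ R ε I n) := by
  have h : SymmetricAlgebra.lift (shiftedLax σ hσ R ε L) =
      (PowerSeries.mapAlgHom (SymmetricAlgebra.lift L)).comp
        (SymmetricAlgebra.lift (universalLax σ hσ R ε)) := by
    apply SymmetricAlgebra.algHom_ext
    ext x n
    simp [coeff_shiftedLax, coeff_universalLax, PowerSeries.mapAlgHom_apply]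
  change PowerSeries.coeff n (SymmetricAlgebra.lift (shiftedLax σ hσ R ε L) I) = _
  rw [h, AlgHom.comp_apply, PowerSeries.mapAlgHom_apply, PowerSeries.coeff_map]
  rfl

/-- The part of degrees `εn, ε(n-1), …, -εN` of the loop `u^{εn} ∇I(L_ε(u))`. -/
noncomputable def gradLoop (N : ℕ) : twistedLoop σ :=
  ∑ k ∈ Finset.range (n + N + 1), twistedMono σ hσ ((ε : ℤ) * ((n : ℤ) - k))
    (gradCoeff (shiftedLax σ hσ R ε L) k (symD I))

theorem nabla_integral :
    nabla (integral σ hσ R ε I n) L = shift R ε (gradLoop σ hσ R ε I n L 0) := by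
  rw [nabla_of_polynomial (integral_eq σ hσ R ε I n), ← sub_eq_zero,
    ← Module.forall_dual_apply_eq_zero_iff ℂ]
  intro θ
  -- Coefficient `n` of the chain rule pairs the `k`-th gradient coefficient with degree `ε(n - k)`,
  -- `k ≤ n`: exactly the truncation with `N = 0`.
  rw [map_sub, sub_eq_zero, apply_evalAt, ← dirDeriv_apply, integralPoly,
    dirDeriv_coeff_lift _ L θ (shiftedLax σ hσ R ε L) (shiftedLax σ hσ R ε θ)
      (fun I n => integral_eq σ hσ R ε I n L)
      (fun x n => by simp [coeff_shiftedLax, coeff_universalLax, dirDeriv_apply]),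
    coeff_contr, Finset.Nat.sum_antidiagonal_eq_sum_range_succ_mk, gradLoop, map_sum, map_sum]
  refine Finset.sum_congr rfl fun k hk => ?_
  have hk' : k ≤ n := Nat.lt_succ_iff.mp (Finset.mem_range.mp hk)
  rw [coeff_shiftedLax, Nat.cast_sub hk']

end GeneralR

/-- The span of the homogeneous loops of degrees `εe` with `e ≤ N`. -/
noncomputable def degreeLE (ε : ℤˣ) (N : ℕ) : Submodule ℂ (twistedLoop σ) :=
  Submodule.span ℂ {X | ∃ e : ℤ, e ≤ N ∧ ∃ x, X = twistedMono σ hσ ((ε : ℤ) * e) x}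

theorem twistedMono_mem_degreeLE {ε : ℤˣ} {N : ℕ} {e : ℤ} (he : e ≤ N) (x : 𝔤) :
    twistedMono σ hσ ((ε : ℤ) * e) x ∈ degreeLE σ hσ ε N :=
  Submodule.subset_span ⟨e, he, x, rfl⟩

theorem degreeLE_mono (ε : ℤˣ) {M N : ℕ} (h : M ≤ N) :
    degreeLE σ hσ ε M ≤ degreeLE σ hσ ε N := by
  refine Submodule.span_mono ?_
  rintro X ⟨e, he, x, rfl⟩
  exact ⟨e, by lia, x, rfl⟩

theorem exists_eq_unit_mul (ε : ℤˣ) (j : ℤ) : ∃ e : ℤ, j = (ε : ℤ) * e :=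
  ⟨ε * j, by rw [← mul_assoc, Int.units_coe_mul_self, one_mul]⟩

theorem exists_mem_degreeLE (ε : ℤˣ) (X : twistedLoop σ) : ∃ N, X ∈ degreeLE σ hσ ε N := by
  induction X using twistedMono_induction σ hσ with
  | h0 => exact ⟨0, zero_mem _⟩
  | hadd X Y hX hY =>
    obtain ⟨M, hM⟩ := hX
    obtain ⟨N, hN⟩ := hY
    exact ⟨max M N, add_mem (degreeLE_mono σ hσ ε (le_max_left M N) hM)
      (degreeLE_mono σ hσ ε (le_max_right M N) hN)⟩
  | hmono j x =>
    obtain ⟨e, rfl⟩ := exists_eq_unit_mul ε j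
    exact ⟨e.toNat, twistedMono_mem_degreeLE σ hσ e.self_le_toNat x⟩

/-! ### Triangular operators: involution and conservation of the zero component. -/

section Triangular

variable (R₀ : fixedSubalgebra σ →ₗ[ℂ] fixedSubalgebra σ)

theorem exists_triangularR_twistedMono (j : ℤ) (x : 𝔤) :
    ∃ y, triangularR σ R₀ (twistedMono σ hσ j x) = twistedMono σ hσ j y := by
  rcases lt_trichotomy j 0 with hj | rfl | hj
  · exact ⟨-x, by rw [triangularR_of_neg σ hσ R₀ hj, map_neg]⟩
  · exact ⟨_, triangularR_zero σ hσ R₀ x⟩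
  · exact ⟨x, triangularR_of_pos σ hσ R₀ hj x⟩

theorem shift_triangularR_of_neg (ε : ℤˣ) {e : ℤ} (he : e < 0) (x : 𝔤) :
    shift (triangularR σ R₀) ε (twistedMono σ hσ ((ε : ℤ) * e) x) = 0 := by
  rcases Int.units_eq_one_or ε with rfl | rfl
  · rw [shift_apply, triangularR_of_neg σ hσ R₀ (by simpa using he)]
    simp
  · rw [shift_apply, triangularR_of_pos σ hσ R₀ (by simpa using he)]
    simp

theorem shift_neg_triangularR_mem (ε : ℤˣ) (X : twistedLoop σ) :
    shift (triangularR σ R₀) (-ε) X ∈ degreeLE σ hσ ε 0 := by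
  induction X using twistedMono_induction σ hσ with
  | h0 => simp
  | hadd X Y hX hY =>
    rw [map_add]
    exact add_mem hX hY
  | hmono j x =>
    obtain ⟨e, rfl⟩ := exists_eq_unit_mul ε j
    rcases lt_or_ge 0 e with he | he
    · have h := shift_triangularR_of_neg σ hσ R₀ (-ε) (neg_lt_zero.mpr he) x
      rw [Units.val_neg, neg_mul_neg] at h
      rw [h]
      exact zero_mem _
    · obtain ⟨y, hy⟩ := exists_triangularR_twistedMono σ hσ R₀ ((ε : ℤ) * e) x
      rw [shift_apply, hy]
      exact add_mem (twistedMono_mem_degreeLE σ hσ (by simpa using he) y)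
        (zsmul_mem (twistedMono_mem_degreeLE σ hσ (by simpa using he) x) _)

variable (ε : ℤˣ) (I : SymmetricAlgebra ℂ 𝔤) (n : ℕ) (L : Module.Dual ℂ (twistedLoop σ))

/-- The extra terms have degrees of sign opposite to `ε`, which `R + ε` kills; the truncation may
thus be lengthened freely. -/
theorem shift_gradLoop (N : ℕ) :
    shift (triangularR σ R₀) ε (gradLoop σ hσ (triangularR σ R₀) ε I n L N) =
      shift (triangularR σ R₀) ε (gradLoop σ hσ (triangularR σ R₀) ε I n L 0) := by
  rw [gradLoop, gradLoop, map_sum, map_sum]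
  refine (Finset.sum_subset (Finset.range_subset_range.mpr (by lia)) fun k _ hk => ?_).symm
  rw [Finset.mem_range, not_lt] at hk
  exact shift_triangularR_of_neg σ hσ R₀ ε (by lia) _

variable {I}

theorem apply_shift_lie_gradLoop (hI : IsCoadjointInvariant I) {N : ℕ} {W : twistedLoop σ}
    (hW : W ∈ degreeLE σ hσ ε N) :
    L (shift (triangularR σ R₀) ε ⁅W, gradLoop σ hσ (triangularR σ R₀) ε I n L N⁆) = 0 := by
  induction hW using Submodule.span_induction with
  | zero => simp
  | add X Y _ _ hX hY => rw [add_lie, map_add, map_add, hX, hY, add_zero]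
  | smul c X _ hX => rw [smul_lie, map_smul, map_smul, hX, smul_zero]
  | mem X hX =>
  obtain ⟨e, he, w, rfl⟩ := hX
  set x := parityProj σ ((ε : ℤ) * e) w
  have hterm (k : ℕ) (y : 𝔤) :
      ⁅twistedMono σ hσ ((ε : ℤ) * e) w, twistedMono σ hσ ((ε : ℤ) * ((n : ℤ) - k)) y⁆ =
        twistedMono σ hσ ((ε : ℤ) * (e + n - k)) ⁅x, y⁆ := by
    rw [lie_twistedMono, ← mul_add, add_sub_assoc]
  rw [gradLoop, lie_sum, map_sum, map_sum]
  simp only [hterm]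
  -- `R + ε` keeps only `k ≤ e + n`. Since `e ≤ N`, the truncation contains all these terms, and
  -- their sum is coefficient `e + n` of the centralizer identity.
  rcases lt_or_ge (e + n) 0 with hneg | hpos
  · refine Finset.sum_eq_zero fun k _ => ?_
    rw [shift_triangularR_of_neg σ hσ R₀ ε (by lia), map_zero]
  · obtain ⟨p, hp⟩ := Int.eq_ofNat_of_zero_le hpos
    rw [hp]
    have hsub : Finset.range (p + 1) ⊆ Finset.range (n + N + 1) :=
      Finset.range_subset_range.mpr (by lia)
    rw [← Finset.sum_subset hsub fun k _ hk => by
      rw [Finset.mem_range, not_lt] at hk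
      rw [shift_triangularR_of_neg σ hσ R₀ ε (by lia), map_zero]]
    rw [← hI.sum_coeff_lie_eq_zero (shiftedLax σ hσ (triangularR σ R₀) ε L) x p]
    refine Finset.sum_congr rfl fun k hk => ?_
    have hk' : k ≤ p := Nat.lt_succ_iff.mp (Finset.mem_range.mp hk)
    rw [coeff_shiftedLax, Nat.cast_sub hk']

include hσ in
/-- All integrals of the hierarchy are in involution. -/
theorem poisson_integral_eq_zero (hR₀ : IsROperator R₀) (hI : IsCoadjointInvariant I) (ε' : ℤˣ)
    {I' : SymmetricAlgebra ℂ 𝔤} (hI' : IsCoadjointInvariant I') (n' : ℕ) :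
    poisson (integral σ hσ (triangularR σ R₀) ε I n)
      (integral σ hσ (triangularR σ R₀) ε' I' n') L = 0 := by
  -- The second gradient is lengthened to match the degrees of the first. The first needs no
  -- lengthening, because the loop bracketed with it lies in `degreeLE σ hσ ε 0`.
  obtain ⟨N, hN⟩ := exists_mem_degreeLE σ hσ ε'
    (shift (triangularR σ R₀) ε (gradLoop σ hσ (triangularR σ R₀) ε I n L 0))
  rw [poisson, nabla_integral, nabla_integral, ← shift_gradLoop σ hσ R₀ ε' I' n' L N,
    (isROperator_triangularR σ hσ R₀ hR₀).shift_lie_shift, map_add,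
    apply_shift_lie_gradLoop σ hσ R₀ ε' n' L hI' hN, ← lie_skew, map_neg, map_neg,
    apply_shift_lie_gradLoop σ hσ R₀ ε n L hI (shift_neg_triangularR_mem σ hσ R₀ ε _), neg_zero,
    add_zero]

theorem apply_constLoop_lie_nabla (hR₀ : ∀ x y : fixedSubalgebra σ, R₀ ⁅x, y⁆ = ⁅x, R₀ y⁆)
    (hI : IsCoadjointInvariant I) (x : fixedSubalgebra σ) :
    L ⁅constLoop σ x, nabla (integral σ hσ (triangularR σ R₀) ε I n) L⁆ = 0 := by
  have hx : constLoop σ x ∈ degreeLE σ hσ ε 0 := by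
    rw [constLoop_eq σ hσ, ← mul_zero (ε : ℤ)]
    exact twistedMono_mem_degreeLE σ hσ le_rfl _
  -- `R + ε` is moved outside the bracket with the constant loop; a loop of degree zero then needs
  -- only `N = 0`.
  rw [nabla_integral, shift_apply, lie_add, ← triangularR_lie_constLoop σ hσ R₀ hR₀, lie_smul]
  exact apply_shift_lie_gradLoop σ hσ R₀ ε n L hI hx

theorem zeroPart_eq_of_flow (hR₀ : ∀ x y : fixedSubalgebra σ, R₀ ⁅x, y⁆ = ⁅x, R₀ y⁆)
    (hI : IsCoadjointInvariant I) {J : Set ℝ} (hJ : IsOpen J) (hJ' : IsPreconnected J)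
    {γ : ℝ → Module.Dual ℂ (twistedLoop σ)}
    (hγ : ∀ t ∈ J, SatisfiesFlowAt (integral σ hσ (triangularR σ R₀) ε I n) γ t)
    {s t : ℝ} (hs : s ∈ J) (ht : t ∈ J) : zeroPart σ (γ s) = zeroPart σ (γ t) := by
  ext x
  have hd (r : ℝ) (hr : r ∈ J) : HasDerivAt (fun r => γ r (constLoop σ x)) 0 r := by
    have h := hγ r hr (constLoop σ x)
    rwa [apply_constLoop_lie_nabla σ hσ R₀ ε n (γ r) hR₀ hI x] at h
  exact hJ.is_const_of_deriv_eq_zero hJ'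
    (fun r hr => (hd r hr).differentiableAt.differentiableWithinAt)
    (fun r hr => (hd r hr).deriv) hs ht

end Triangular

end Hierarchy

end LoopHierarchy

theorem proposition3 {𝔤 : Type*} [LieRing 𝔤] [LieAlgebra ℂ 𝔤] [FiniteDimensional ℂ 𝔤]
    [LieAlgebra.HasCentralRadical ℂ 𝔤]
    (σ : 𝔤 ≃ₗ⁅ℂ⁆ 𝔤) (hσ : ∀ x, σ (σ x) = x)
    (gp gm : LieIdeal ℂ (fixedSubalgebra σ)) (hsplit : IsCompl gp gm)
    [LieAlgebra.HasCentralRadical ℂ gp] [LieAlgebra.HasCentralRadical ℂ gm] :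
    -- `R_0 = P_0^+ - P_0^-` is an R-operator on `𝔤_0`
    IsROperator (splitR gp gm hsplit) ∧
    -- the integrals of the hierarchy have algebra-valued gradients
    (∀ (ε : ℤˣ) (I : SymmetricAlgebra ℂ 𝔤) (n : ℕ) (L : Module.Dual ℂ (twistedLoop σ)),
      HasAlgGradientAt (splitIntegral σ hσ gp gm hsplit ε I n) L (nabla (splitIntegral σ hσ gp gm hsplit ε I n) L)) ∧
    -- `r_±^*(L^(0)) = L^(0)_±`
    (∀ L : Module.Dual ℂ (twistedLoop σ),
      (rMap (splitR gp gm hsplit) 1).dualMap (zeroPart σ L) = (idealProj gp gm hsplit).dualMap (zeroPart σ L) ∧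
      (rMap (splitR gp gm hsplit) (-1)).dualMap (zeroPart σ L) = (idealProj gm gp hsplit.symm).dualMap (zeroPart σ L)) ∧
    -- `L^(0)_±` are integrals of all flows: the components of `L^(0)` Poisson commute with all `H`
    (∀ (ε : ℤˣ) (I : SymmetricAlgebra ℂ 𝔤), IsCoadjointInvariant I → ∀ (n : ℕ)
      (X : fixedSubalgebra σ) (L : Module.Dual ℂ (twistedLoop σ)),
      poisson (coordFun (constLoop σ X)) (splitIntegral σ hσ gp gm hsplit ε I n) L
        = 0) ∧
    -- and `L^(0)_±` are constant along every solution of every flow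
    (∀ (ε : ℤˣ) (I : SymmetricAlgebra ℂ 𝔤), IsCoadjointInvariant I → ∀ (n : ℕ)
      (J : Set ℝ), IsOpen J → IsPreconnected J →
      ∀ γ : ℝ → Module.Dual ℂ (twistedLoop σ),
      (∀ t ∈ J, SatisfiesFlowAt (splitIntegral σ hσ gp gm hsplit ε I n) γ t) → ∀ s ∈ J, ∀ t ∈ J,
      (rMap (splitR gp gm hsplit) 1).dualMap (zeroPart σ (γ s)) =
        (rMap (splitR gp gm hsplit) 1).dualMap (zeroPart σ (γ t)) ∧
      (rMap (splitR gp gm hsplit) (-1)).dualMap (zeroPart σ (γ s)) =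
        (rMap (splitR gp gm hsplit) (-1)).dualMap (zeroPart σ (γ t))) ∧
    -- the reduction `L^(0) = K_+ + K_-`
    (∀ (kp : Module.Dual ℂ (LieAlgebra.center ℂ gp)) (km : Module.Dual ℂ (LieAlgebra.center ℂ gm)),
      ∃ K : Module.Dual ℂ (fixedSubalgebra σ),
        -- `K = K_+ + K_-` is a well-defined element of `𝔤_0^*`
        (∀ K' : Module.Dual ℂ (fixedSubalgebra σ),
          IsSumOfCentral gp gm kp km K' ↔ K' = K) ∧
        -- the constraints `L^(0) = K` Poisson commute on the surface that they define
        (∀ L : Module.Dual ℂ (twistedLoop σ), zeroPart σ L = K →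
          ∀ X Y : fixedSubalgebra σ,
          poisson (coordFun (constLoop σ X))
            (coordFun (constLoop σ Y)) L = 0) ∧
        -- this surface is preserved by all flows of the hierarchy
        (∀ (ε : ℤˣ) (I : SymmetricAlgebra ℂ 𝔤), IsCoadjointInvariant I → ∀ (n : ℕ)
          (J : Set ℝ), IsOpen J → IsPreconnected J →
          ∀ γ : ℝ → Module.Dual ℂ (twistedLoop σ),
          (∀ t ∈ J, SatisfiesFlowAt (splitIntegral σ hσ gp gm hsplit ε I n) γ t) →
          (∃ s ∈ J, zeroPart σ (γ s) = K) → ∀ t ∈ J, zeroPart σ (γ t) = K) ∧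
        -- on this surface all zero-curvature equations, of equal and of opposite signs, hold
        (∀ (ε ε' : ℤˣ) (I I' : SymmetricAlgebra ℂ 𝔤), IsCoadjointInvariant I →
          IsCoadjointInvariant I' → ∀ (n n' : ℕ)
          (L : Module.Dual ℂ (twistedLoop σ)), zeroPart σ L = K →
          ZeroCurvatureAt (splitIntegral σ hσ gp gm hsplit ε I n) (splitIntegral σ hσ gp gm hsplit ε' I' n') L)) := by
  
  have hRlie := splitR_lie gp gm hsplit
  have hRop := isROperator_splitR gp gm hsplit
  have hzero {ε : ℤˣ} {I : SymmetricAlgebra ℂ 𝔤} (hI : IsCoadjointInvariant I) (n : ℕ)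
      {J : Set ℝ} (hJ : IsOpen J) (hJ' : IsPreconnected J)
      {γ : ℝ → Module.Dual ℂ (twistedLoop σ)}
      (hγ : ∀ t ∈ J, SatisfiesFlowAt (splitIntegral σ hσ gp gm hsplit ε I n) γ t)
      {s t : ℝ} (hs : s ∈ J) (ht : t ∈ J) : zeroPart σ (γ s) = zeroPart σ (γ t) :=
    zeroPart_eq_of_flow σ hσ _ ε n hRlie hI hJ hJ' hγ hs ht
  refine ⟨hRop, fun ε I n L => ?_, fun L => ?_, fun ε I hI n X L => ?_,
    fun ε I hI n J hJ hJ' γ hγ s hs t ht => ?_, fun kp km => ?_⟩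
  · have hpoly := integral_eq σ hσ (triangularR σ (splitR gp gm hsplit)) ε I n
    exact (nabla_of_polynomial hpoly L).symm ▸ hasAlgGradientAt_of_polynomial hpoly L
  · rw [rMap_splitR_one, rMap_splitR_neg_one]
    exact ⟨rfl, rfl⟩
  · rw [poisson, nabla_coordFun]
    exact apply_constLoop_lie_nabla σ hσ _ ε n L hRlie hI X
  · rw [hzero hI n hJ hJ' hγ hs ht]
    exact ⟨rfl, rfl⟩
  · obtain ⟨K, hK, huniq⟩ := existsUnique_isSumOfCentral hsplit kp km
    refine ⟨K, fun K' => ⟨huniq K', fun h => h ▸ hK⟩, fun L hL X Y => ?_,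
      fun ε I hI n J hJ hJ' γ hγ ⟨s, hs, hsK⟩ t ht => ?_, fun ε ε' I I' hI hI' n n' L _ => ?_⟩
    · rw [poisson, nabla_coordFun, nabla_coordFun, ← constLoop_lie]
      -- On the surface the bracket of two constraints is the value of `K` on a commutator.
      exact (LinearMap.congr_fun hL ⁅X, Y⁆).trans (hK.apply_lie_eq_zero hsplit X Y)
    · rw [← hsK]
      exact hzero hI n hJ hJ' hγ ht hs
    · exact zeroCurvatureAt_of_poisson_eq_zero (integral_eq σ hσ _ ε I n)
        (integral_eq σ hσ _ ε' I' n')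
        (fun L => poisson_integral_eq_zero σ hσ _ ε n L hRop hI ε' hI' n') L
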